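/- Let $k$ be a field of characteristic zero and $N\ge 0$. Let $\mathcal E_N$ be the Fomin–Kirillov algebra, i.e. the unital associative $k$-algebra generated by symbols $[ij]$ ($1\le i\ne j\le N$) with relations $$[ij]=-[ji],\quad [ij]^2=0,\quad [ij][lm]=[lm][ij],\quad [ij][jl]+[jl][li]+[li][ij]=0$$ for distinct $i,j,l,m$. For a 2-cycle $a=(ij)$ with $i<j$ write $e_a=[ij]$. Regard $\mathcal E_N$ as a crossed $S_N$-module by $g.[ij]=[g(i)\,g(j)]$ and $S_N$-degree $|[ij]|=(ij)$, both extended multiplicatively, with induced braiding $\Psi(x\otimes y)=|x|.y\otimes x$ for $x$ homogeneous of degree $|x|$. Then $\Psi(e_a\otimes e_b)=\zeta_{a,b}\,e_{aba^{-1}}\otimes e_a$, where for $g\in S_N$ the sign $\zeta_{g,b}=\pm1$ is defined by $g.e_b=\zeta_{g,b}e_{gbg^{-1}}$. Let $\Psi^{c_1c_2}_{b_1b_2}$ be the matrix of $\Psi$ on generators, $\Psi(e_{b_1}\otimes e_{b_2})=\sum_{c_1,c_2} \Psi^{c_1c_2}_{b_1b_2}\,e_{c_1}\otimes e_{c_2}$,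 and let $\Psi_{i,i+1}$ be this matrix acting in places $i,i+1$ of words in the labels. Define the braided integer and factorial matrices by $$[n,\Psi]=\mathrm{id}+\Psi_{12}+\Psi_{12}\Psi_{23}+\cdots+\Psi_{12}\Psi_{23}\cdots\Psi_{n-1,n},\qquad [n,\Psi]!=(\mathrm{id}\otimes[n-1,\Psi]!)\,[n,\Psi],\qquad [0,\Psi]!=1 .$$ Then $\mathcal E_N$ is a braided group, i.e. a Hopf algebra (with product, unit, coproduct $\underline\Delta$, counit $\underline\epsilon$ and antipode $\underline S$) in the braided category of crossed $S_N$-modules, with $\underline\Delta e_a=e_a\otimes1+1\otimes e_a$ and $\underline\epsilon(e_a)=0$ for all 2-cycles $a$; and $\mathcal E_N$ is self-dually paired as such: there is a bilinear pairing $\langle\ ,\ \rangle:\mathcal E_N\otimes\mathcal E_N\to k$ which is a morphism to the trivial crossed module and satisfies, for all $x,y,z\in\mathcal E_N$, $$\langle xy,z\rangle=\langle x\otimes y,\underline\Delta z\rangle,\quad \langle x,yz\rangle=\langle\underline\Delta x,y\otimes z\rangle,\quad \langle1,x\rangle=\underline\epsilon(x)=\langle x,1\rangle,\quad \langle\underline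 Sx,y\rangle=\langle x,\underline Sy\rangle,$$ where tensor squares are paired from the inside out, $\langle x\otimes y,z\otimes w\rangle=\langle y,z\rangle\langle x,w\rangle$. This pairing is given on generators by $\langle e_a,e_b\rangle=\delta_{a,b}$ and on monomials, for all $n,m\ge0$ and all 2-cycles $a_1,\dots,a_n,b_1,\dots,b_m$, by $$\langle e_{a_n}\cdots e_{a_1},\,e_{b_1}\cdots e_{b_m}\rangle=\delta_{n,m}\,([n,\Psi]!)^{a_1\cdots a_n}_{b_1\cdots b_n}.$$ -/

import Mathlib

open scoped TensorProduct

noncomputable section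

namespace FominKirillov

/-! ### Crossed modules over a group and their braiding -/

section General

/-- A (left) crossed `G`-module over `k`: a `G`-module `M` together with a `G`-grading which is
equivariant for the conjugation action. The grading is encoded as a left coaction
`M → kG ⊗ M`; the homogeneous elements of degree `g` are those `x` with
`coact x = g ⊗ x`. -/
structure CrossedModule (k G M : Type*) [CommRing k] [Group G] [AddCommGroup M] [Module k M] where
  /-- the action of `G` -/
  act : Representation k G M
  /-- the coaction of `kG`, i.e. the `G`-grading -/
  coact : M →ₗ[k] MonoidAlgebra k G ⊗[k] M
  coact_coassoc : coact.lTensor (MonoidAlgebra k G) ∘ₗ coact =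
    (TensorProduct.assoc k (MonoidAlgebra k G) (MonoidAlgebra k G) M).toLinearMap ∘ₗ
      (Coalgebra.comul (R := k) (A := MonoidAlgebra k G)).rTensor M ∘ₗ coact
  coact_counit : TensorProduct.lid k M ∘ₗ
    (Coalgebra.counit (R := k) (A := MonoidAlgebra k G)).rTensor M ∘ₗ coact = LinearMap.id
  /-- `|g.x| = g |x| g⁻¹` -/
  coact_act : ∀ (g : G) (x : M), coact (act g x) =
    TensorProduct.map
      (MonoidAlgebra.mapDomainAlgHom k k (MulAut.conj g : G →* G)).toLinearMap (act g) (coact x)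

variable {k G M N : Type*} [CommRing k] [Group G] [AddCommGroup M] [Module k M]
  [AddCommGroup N] [Module k N]

/-- The braiding `Ψ(x ⊗ y) = |x|.y ⊗ x` (for `x` homogeneous of degree `|x|`). -/
def CrossedModule.braid (X : CrossedModule k G M) (Y : CrossedModule k G N) :
    M ⊗[k] N →ₗ[k] N ⊗[k] M :=
  (TensorProduct.lift Y.act.asAlgebraHom.toLinearMap).rTensor M ∘ₗ
    (TensorProduct.assoc k (MonoidAlgebra k G) N M).symm.toLinearMap ∘ₗ
      (TensorProduct.comm k M N).toLinearMap.lTensor (MonoidAlgebra k G) ∘ₗ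
        (TensorProduct.assoc k (MonoidAlgebra k G) M N).toLinearMap ∘ₗ X.coact.rTensor N

/-- The coaction (i.e. the product grading) on the tensor product of two crossed modules:
`|x ⊗ y| = |x| |y|`. -/
def CrossedModule.tensorCoact (X : CrossedModule k G M) (Y : CrossedModule k G N) :
    M ⊗[k] N →ₗ[k] MonoidAlgebra k G ⊗[k] (M ⊗[k] N) :=
  (LinearMap.mul' k (MonoidAlgebra k G)).rTensor (M ⊗[k] N) ∘ₗ
    (TensorProduct.tensorTensorTensorComm k (MonoidAlgebra k G) M
      (MonoidAlgebra k G) N).toLinearMap ∘ₗ TensorProduct.map X.coact Y.coact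

/-! ### Braided groups -/

variable {B C : Type*} [Ring B] [Algebra k B] [Ring C] [Algebra k C]

/-- The product `(a ⊗ b)(c ⊗ d) = a Ψ(b ⊗ c) d` of the braided tensor product algebra, as a
linear map on `(B ⊗ B) ⊗ (B ⊗ B)`. -/
def braidedMul (X : CrossedModule k G B) :
    (B ⊗[k] B) ⊗[k] (B ⊗[k] B) →ₗ[k] B ⊗[k] B :=
  TensorProduct.map (LinearMap.mul' k B) (LinearMap.mul' k B) ∘ₗ
    (TensorProduct.tensorTensorTensorAssoc k B B B B).symm.toLinearMap ∘ₗ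
      ((X.braid X).lTensor B).rTensor B ∘ₗ
        (TensorProduct.tensorTensorTensorAssoc k B B B B).toLinearMap

/-- A braided group structure (i.e. the structure of a Hopf algebra in the braided category of
crossed `G`-modules) on an algebra `B` carrying a crossed `G`-module structure `X`.
The coalgebra structure is part of the data, as is the braided antipode; all structure maps are
morphisms of crossed modules, and the coproduct is an algebra map to the braided tensor
product algebra. -/
structure BraidedGroup (X : CrossedModule k G B) extends Coalgebra k B where
  /-- the braided antipode -/
  antipode : B →ₗ[k] B
  /- The unit and the product are morphisms. -/
  act_one : ∀ g, X.act g 1 = 1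
  act_mul : ∀ g x y, X.act g (x * y) = X.act g x * X.act g y
  coact_one : X.coact 1 = 1 ⊗ₜ 1
  coact_mul : ∀ x y, X.coact (x * y) = X.coact x * X.coact y
  /- The coproduct, the counit and the antipode are morphisms. -/
  comul_act : ∀ g x, comul (X.act g x) = TensorProduct.map (X.act g) (X.act g) (comul x)
  comul_coact : ∀ x, X.tensorCoact X (comul x) = comul.lTensor (MonoidAlgebra k G) (X.coact x)
  counit_act : ∀ g x, counit (X.act g x) = counit x
  counit_coact : ∀ x, counit.lTensor (MonoidAlgebra k G) (X.coact x) = 1 ⊗ₜ counit x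
  antipode_act : ∀ g x, antipode (X.act g x) = X.act g (antipode x)
  antipode_coact : ∀ x,
    X.coact (antipode x) = antipode.lTensor (MonoidAlgebra k G) (X.coact x)
  /- The counit and the coproduct are algebra maps. -/
  counit_one : counit 1 = 1
  counit_mul : ∀ x y, counit (x * y) = counit x * counit y
  comul_one : comul 1 = 1 ⊗ₜ 1
  comul_mul : ∀ x y, comul (x * y) = braidedMul X (comul x ⊗ₜ comul y)
  /- The antipode axioms. -/
  mul_antipode_left : ∀ x,
    LinearMap.mul' k B (antipode.rTensor B (comul x)) = algebraMap k B (counit x)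
  mul_antipode_right : ∀ x,
    LinearMap.mul' k B (antipode.lTensor B (comul x)) = algebraMap k B (counit x)

/-- The extension of a pairing to tensor squares, pairing the inner factors first and then the
outer ones: `⟨x ⊗ y, z ⊗ w⟩ = ⟨y, z⟩ ⟨x, w⟩`. -/
def nestedPairing (p : M →ₗ[k] N →ₗ[k] k) (s : M ⊗[k] M) (t : N ⊗[k] N) : k :=
  LinearMap.mul' k k (TensorProduct.map₂ p p s (TensorProduct.comm k N N t))

/-- `p` is a duality pairing of the braided groups `H` and `K`: it is a morphism to the trivial
crossed module, product and coproduct are adjoint to each other on both sides, so are unit and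
counit, and the antipodes are adjoint. -/
structure IsBraidedPairing {X : CrossedModule k G B} {Y : CrossedModule k G C}
    (H : BraidedGroup X) (K : BraidedGroup Y) (p : B →ₗ[k] C →ₗ[k] k) : Prop where
  act_invariant : ∀ g x y, p (X.act g x) (Y.act g y) = p x y
  coact_invariant : ∀ x y, (TensorProduct.lift p).lTensor (MonoidAlgebra k G)
    (X.tensorCoact Y (x ⊗ₜ y)) = 1 ⊗ₜ p x y
  one_left : ∀ y, p 1 y = K.counit y
  one_right : ∀ x, p x 1 = H.counit x
  mul_left : ∀ x x' y, p (x * x') y = nestedPairing p (x ⊗ₜ x') (K.comul y)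
  mul_right : ∀ x y y', p x (y * y') = nestedPairing p (H.comul x) (y ⊗ₜ y')
  antipode_adjoint : ∀ x y, p (H.antipode x) y = p x (K.antipode y)

end General

/-! ### The algebra `E_N` -/

/-- Ordered pairs `(i,j)` with `i ≠ j`, labelling the symbols `[ij]`. -/
abbrev OrdPair (N : ℕ) : Type := {p : Fin N × Fin N // p.1 ≠ p.2}

/-- The set of pairs `i < j`, labelling the basis `[ij]` of the space of generators; it is in
bijection with the 2-cycles `(ij)` of `S_N`. -/
abbrev Cyc (N : ℕ) : Type := {p : Fin N × Fin N // p.1 < p.2}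

/-- Permutations act on ordered pairs. -/
def OrdPair.perm {N : ℕ} (g : Equiv.Perm (Fin N)) (p : OrdPair N) : OrdPair N :=
  ⟨(g p.1.1, g p.1.2), fun h => p.2 (g.injective h)⟩

/-- The symbol `[ij]` in the free algebra. -/
def fkSym (k : Type*) [CommRing k] {N : ℕ} (i j : Fin N) (h : i ≠ j) : FreeAlgebra k (OrdPair N) :=
  FreeAlgebra.ι k ⟨(i, j), h⟩

/-- The defining relations. -/
inductive FKRel (k : Type*) [CommRing k] (N : ℕ) :
    FreeAlgebra k (OrdPair N) → FreeAlgebra k (OrdPair N) → Prop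
  | antisymm (i j : Fin N) (h : i ≠ j) : FKRel k N (fkSym k i j h) (-fkSym k j i h.symm)
  | sq (i j : Fin N) (h : i ≠ j) : FKRel k N (fkSym k i j h * fkSym k i j h) 0
  | comm (i j l m : Fin N) (hij : i ≠ j) (hlm : l ≠ m) (hil : i ≠ l) (him : i ≠ m)
      (hjl : j ≠ l) (hjm : j ≠ m) :
      FKRel k N (fkSym k i j hij * fkSym k l m hlm) (fkSym k l m hlm * fkSym k i j hij)
  | tri (i j l : Fin N) (hij : i ≠ j) (hjl : j ≠ l) (hli : l ≠ i) :
      FKRel k N (fkSym k i j hij * fkSym k j l hjl + fkSym k j l hjl * fkSym k l i hli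
        + fkSym k l i hli * fkSym k i j hij) 0

/-- The Fomin–Kirillov algebra `E_N`: the free algebra on the symbols `[ij]`, modulo the defining
relations. -/
def FK (k : Type*) [CommRing k] (N : ℕ) : Type _ := RingQuot (FKRel k N)

/-- The ring structure of `E_N`. -/
def fkRing (k : Type*) [CommRing k] (N : ℕ) : Ring (FK k N) := RingQuot.instRing (FKRel k N)

instance (k : Type*) [CommRing k] (N : ℕ) : Ring (FK k N) := fkRing k N

/-- The `k`-algebra structure of `E_N`. -/
def fkAlgebra (k : Type*) [CommRing k] (N : ℕ) : Algebra k (FK k N) :=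
  RingQuot.instAlgebra (FKRel k N)

instance (k : Type*) [CommRing k] (N : ℕ) : Algebra k (FK k N) := fkAlgebra k N

variable (k : Type*) [CommRing k] {N : ℕ}

variable (N) in
/-- The quotient map. -/
def fkMk : FreeAlgebra k (OrdPair N) →ₐ[k] FK k N := RingQuot.mkAlgHom k (FKRel k N)

/-- The element `[ij]` of `E_N`. -/
def br (p : OrdPair N) : FK k N := fkMk k N (FreeAlgebra.ι k p)

/-- The generator `e_a = [ij]`, for `a = (ij)` with `i < j`. -/
def gen (a : Cyc N) : FK k N := br k ⟨a.1, a.2.ne⟩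

variable {k}

lemma fkMk_rel {x y : FreeAlgebra k (OrdPair N)} (h : FKRel k N x y) : fkMk k N x = fkMk k N y :=
  RingQuot.mkAlgHom_rel k h

/-- The universal property of `E_N`. -/
def fkLift {A : Type*} [Ring A] [Algebra k A] (f : FreeAlgebra k (OrdPair N) →ₐ[k] A)
    (hf : ∀ ⦃x y⦄, FKRel k N x y → f x = f y) : FK k N →ₐ[k] A :=
  RingQuot.liftAlgHom k ⟨f, hf⟩

lemma fkLift_mk {A : Type*} [Ring A] [Algebra k A] (f : FreeAlgebra k (OrdPair N) →ₐ[k] A)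
    (hf : ∀ ⦃x y⦄, FKRel k N x y → f x = f y) (x : FreeAlgebra k (OrdPair N)) :
    fkLift f hf (fkMk k N x) = f x :=
  RingQuot.liftAlgHom_mkAlgHom_apply k f hf x

lemma fkMk_surjective : Function.Surjective (fkMk k N) := RingQuot.mkAlgHom_surjective k (FKRel k N)

lemma br_antisymm (i j : Fin N) (h : i ≠ j) : br k ⟨(i, j), h⟩ = -br k ⟨(j, i), h.symm⟩ := by
  simpa [fkSym, br] using fkMk_rel (FKRel.antisymm (k := k) i j h)

lemma br_sq (i j : Fin N) (h : i ≠ j) : br k ⟨(i, j), h⟩ * br k ⟨(i, j), h⟩ = 0 := by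
  simpa [fkSym, br] using fkMk_rel (FKRel.sq (k := k) i j h)

lemma br_comm (i j l m : Fin N) (hij : i ≠ j) (hlm : l ≠ m) (hil : i ≠ l) (him : i ≠ m)
    (hjl : j ≠ l) (hjm : j ≠ m) :
    br k ⟨(i, j), hij⟩ * br k ⟨(l, m), hlm⟩ = br k ⟨(l, m), hlm⟩ * br k ⟨(i, j), hij⟩ := by
  simpa [fkSym, br] using
    fkMk_rel (FKRel.comm (k := k) i j l m hij hlm hil him hjl hjm)

lemma br_tri (i j l : Fin N) (hij : i ≠ j) (hjl : j ≠ l) (hli : l ≠ i) :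
    br k ⟨(i, j), hij⟩ * br k ⟨(j, l), hjl⟩ + br k ⟨(j, l), hjl⟩ * br k ⟨(l, i), hli⟩
      + br k ⟨(l, i), hli⟩ * br k ⟨(i, j), hij⟩ = 0 := by
  simpa [fkSym, br] using fkMk_rel (FKRel.tri (k := k) i j l hij hjl hli)

lemma fkHom_ext {A : Type*} [Ring A] [Algebra k A] {f g : FK k N →ₐ[k] A}
    (h : ∀ p, f (br k p) = g (br k p)) : f = g := by
  have h' : f.comp (fkMk k N) = g.comp (fkMk k N) := by
    ext p
    exact h p
  ext x
  obtain ⟨y, rfl⟩ := fkMk_surjective x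
  exact congrArg (fun u => u y) h'

/-- The action of a permutation, the algebra map with `g.[ij] = [g(i) g(j)]`. -/
def actHom (g : Equiv.Perm (Fin N)) : FK k N →ₐ[k] FK k N :=
  fkLift (FreeAlgebra.lift k fun p => br k (p.perm g)) <| by
    intro x y h
    induction h with
    | antisymm i j h =>
      simpa [fkSym, OrdPair.perm] using br_antisymm (g i) (g j) (g.injective.ne h)
    | sq i j h => simpa [fkSym, OrdPair.perm] using br_sq (g i) (g j) (g.injective.ne h)
    | comm i j l m hij hlm hil him hjl hjm =>
      simpa [fkSym, OrdPair.perm] using br_comm (g i) (g j) (g l) (g m) (g.injective.ne hij)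
        (g.injective.ne hlm) (g.injective.ne hil) (g.injective.ne him) (g.injective.ne hjl)
        (g.injective.ne hjm)
    | tri i j l hij hjl hli =>
      simpa [fkSym, OrdPair.perm] using br_tri (g i) (g j) (g l) (g.injective.ne hij)
        (g.injective.ne hjl) (g.injective.ne hli)

@[simp] lemma actHom_br (g : Equiv.Perm (Fin N)) (p : OrdPair N) :
    actHom g (br k p) = br k (p.perm g) := by
  simp [actHom, br, fkLift_mk]

/-- The `S_N`-grading, the algebra map with `[ij] ↦ (ij) ⊗ [ij]`. -/
def coactHom : FK k N →ₐ[k] MonoidAlgebra k (Equiv.Perm (Fin N)) ⊗[k] FK k N :=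
  fkLift (FreeAlgebra.lift k fun p =>
      MonoidAlgebra.single (Equiv.swap p.1.1 p.1.2) 1 ⊗ₜ br k p) <| by
    intro x y h
    induction h with
    | antisymm i j h =>
      simp [fkSym, br_antisymm i j h, Equiv.swap_comm i j, TensorProduct.tmul_neg]
    | sq i j h => simp [fkSym, br_sq]
    | comm i j l m hij hlm hil him hjl hjm =>
      have : Equiv.swap i j * Equiv.swap l m = Equiv.swap l m * Equiv.swap i j := by
        rw [Equiv.mul_swap_eq_swap_mul, Equiv.swap_apply_of_ne_of_ne hil.symm hjl.symm,
          Equiv.swap_apply_of_ne_of_ne him.symm hjm.symm]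
      simp [fkSym, MonoidAlgebra.single_mul_single, this, br_comm i j l m hij hlm hil him hjl hjm]
    | tri i j l hij hjl hli =>
      have h1 : Equiv.swap j l * Equiv.swap l i = Equiv.swap i j * Equiv.swap j l := by
        rw [Equiv.mul_swap_eq_swap_mul, Equiv.swap_apply_right,
          Equiv.swap_apply_of_ne_of_ne hij hli.symm, Equiv.swap_comm j i]
      have h2 : Equiv.swap l i * Equiv.swap i j = Equiv.swap i j * Equiv.swap j l := by
        rw [Equiv.mul_swap_eq_swap_mul, Equiv.swap_apply_right,
          Equiv.swap_apply_of_ne_of_ne hjl hij.symm, Equiv.swap_comm l j, h1]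
      simp [fkSym, MonoidAlgebra.single_mul_single, h1, h2, ← TensorProduct.tmul_add, br_tri]

@[simp] lemma coactHom_br (p : OrdPair N) : coactHom (k := k) (br k p) =
    MonoidAlgebra.single (Equiv.swap p.1.1 p.1.2) 1 ⊗ₜ br k p := by
  simp [coactHom, br, fkLift_mk]

variable (k N) in
/-- The crossed `S_N`-module structure on `E_N`: `g.[ij] = [g(i) g(j)]` and `|[ij]| = (ij)`,
extended multiplicatively. -/
def crossed : CrossedModule k (Equiv.Perm (Fin N)) (FK k N) where
  act :=
    { toFun := fun g => (actHom g).toLinearMap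
      map_one' := by
        have : actHom (1 : Equiv.Perm (Fin N)) = AlgHom.id k (FK k N) :=
          fkHom_ext fun p => by simp [OrdPair.perm]
        rw [this]; rfl
      map_mul' := fun g h => by
        have : actHom (g * h) = (actHom g).comp (actHom (k := k) h) :=
          fkHom_ext fun p => by simp [OrdPair.perm]
        rw [this]; rfl }
  coact := coactHom.toLinearMap
  coact_coassoc := by
    have : (Algebra.TensorProduct.map (AlgHom.id k (MonoidAlgebra k (Equiv.Perm (Fin N))))
        (coactHom (k := k) (N := N))).comp (coactHom (k := k) (N := N)) =
      (Algebra.TensorProduct.assoc k k k _ _ _).toAlgHom.comp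
        ((Algebra.TensorProduct.map (Bialgebra.comulAlgHom k _) (AlgHom.id k _)).comp (coactHom (k := k) (N := N))) :=
      fkHom_ext fun p => by simp
    exact congrArg AlgHom.toLinearMap this
  coact_counit := by
    have : (Algebra.TensorProduct.lid k (FK k N)).toAlgHom.comp
        ((Algebra.TensorProduct.map (Bialgebra.counitAlgHom k _) (AlgHom.id k _)).comp (coactHom (k := k) (N := N))) =
        AlgHom.id k _ :=
      fkHom_ext fun p => by simp
    exact congrArg AlgHom.toLinearMap this
  coact_act := fun g x => by
    have : coactHom.comp (actHom (k := k) g) = (Algebra.TensorProduct.map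
        (MonoidAlgebra.mapDomainAlgHom k k (MulAut.conj g : Equiv.Perm (Fin N) →* _))
        (actHom g)).comp coactHom :=
      fkHom_ext fun p => by
        simp [OrdPair.perm, Equiv.swap_apply_apply]
    exact congrArg (fun f => f x) this

/-! ### Braided factorial matrices -/

/-- The 2-cycle `g a g⁻¹`. -/
def Cyc.conj (g : Equiv.Perm (Fin N)) (a : Cyc N) : Cyc N :=
  if h : g a.1.1 < g a.1.2 then ⟨(g a.1.1, g a.1.2), h⟩
  else ⟨(g a.1.2, g a.1.1), lt_of_le_of_ne (not_lt.mp h) fun h' => a.2.ne' (g.injective h')⟩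

variable (k) in
/-- The sign `ζ` with `g.e_a = ζ_{g,a} e_{g a g⁻¹}`. -/
def zeta (g : Equiv.Perm (Fin N)) (a : Cyc N) : k := if g a.1.1 < g a.1.2 then 1 else -1

/-- The permutation `(ij)` of `a = (ij)`. -/
def Cyc.swap (a : Cyc N) : Equiv.Perm (Fin N) := Equiv.swap a.1.1 a.1.2

variable (k N) in
/-- The matrix of the braiding on generators: upper indices `c` are rows, lower indices `b` are
columns, so `Ψ(e_{b₁} ⊗ e_{b₂}) = ∑_c Ψ^{c₁c₂}_{b₁b₂} e_{c₁} ⊗ e_{c₂}`, where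
`Ψ(e_a ⊗ e_b) = a.e_b ⊗ e_a = ζ_{a,b} e_{aba⁻¹} ⊗ e_a`. -/
def psi : Matrix (Cyc N × Cyc N) (Cyc N × Cyc N) k := fun c b =>
  if c = (b.2.conj b.1.swap, b.1) then zeta k b.1.swap b.2 else 0

/-- `g.e_a = ζ_{g,a} e_{g a g⁻¹}`. -/
lemma act_gen (g : Equiv.Perm (Fin N)) (a : Cyc N) :
    (crossed k N).act g (gen k a) = zeta k g a • gen k (a.conj g) := by
  change actHom g (br k _) = _
  rw [actHom_br]
  by_cases h : g a.1.1 < g a.1.2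
  · simp [zeta, Cyc.conj, h, gen, OrdPair.perm]
  · have hz : zeta k g a = -1 := if_neg h
    have hc : a.conj g = ⟨(g a.1.2, g a.1.1), lt_of_le_of_ne (not_lt.mp h)
      fun h' => a.2.ne' (g.injective h')⟩ := dif_neg h
    rw [hz, hc, neg_one_smul]
    exact br_antisymm _ _ _

/-- `psi` is the matrix of the braiding of `E_N` on the generators. -/
lemma braid_gen (a b : Cyc N) :
    (crossed k N).braid (crossed k N) (gen k a ⊗ₜ gen k b) =
      ∑ c : Cyc N × Cyc N, psi k N c (a, b) • (gen k c.1 ⊗ₜ[k] gen k c.2) := by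
  have h : (crossed k N).coact (gen k a) = MonoidAlgebra.single a.swap 1 ⊗ₜ gen k a :=
    coactHom_br _
  simp [CrossedModule.braid, h, psi, ite_smul, act_gen, TensorProduct.smul_tmul']

variable (k N) in
/-- The matrix of `Ψ_{i,i+1}`, i.e. of `Ψ` acting in two neighbouring places of words
of length `m + 1`. -/
def psiAt {m : ℕ} (i : Fin m) : Matrix (Fin (m + 1) → Cyc N) (Fin (m + 1) → Cyc N) k := fun c b =>
  if ∀ j, j ≠ i.castSucc → j ≠ i.succ → c j = b j then
    psi k N (c i.castSucc, c i.succ) (b i.castSucc, b i.succ) else 0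

variable (k N) in
/-- The braided integer matrix
`[m + 1, Ψ] = id + Ψ_{12} + Ψ_{12} Ψ_{23} + ⋯ + Ψ_{12} Ψ_{23} ⋯ Ψ_{m,m+1}`. -/
def braidedInt (m : ℕ) : Matrix (Fin (m + 1) → Cyc N) (Fin (m + 1) → Cyc N) k :=
  ∑ r : Fin (m + 1), ((List.finRange (r : ℕ)).map fun i : Fin (r : ℕ) =>
    psiAt k N (i.castLE (Nat.lt_succ_iff.mp r.isLt))).prod

/-- The matrix `id ⊗ A`. -/
def idTensor {m : ℕ} (A : Matrix (Fin m → Cyc N) (Fin m → Cyc N) k) :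
    Matrix (Fin (m + 1) → Cyc N) (Fin (m + 1) → Cyc N) k := fun c b =>
  if c 0 = b 0 then A (Fin.tail c) (Fin.tail b) else 0

variable (k N) in
/-- The braided factorial matrix `[n, Ψ]! = (id ⊗ [n - 1, Ψ]!) [n, Ψ]`, with `[0, Ψ]! = 1`. -/
def braidedFactorial : (n : ℕ) → Matrix (Fin n → Cyc N) (Fin n → Cyc N) k
  | 0 => 1
  | m + 1 => idTensor (braidedFactorial m) * braidedInt k N m

variable (k) in
/-- The monomial `e_{b_1} ⋯ e_{b_m}`. -/
def fkMonomial {m : ℕ} (b : Fin m → Cyc N) : FK k N := (List.ofFn fun i => gen k (b i)).prod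

end FominKirillov

end

open FominKirillov

/-!
Everything is built from operators attached to a symbol `e = [ij]` of degree `|e| = (ij)`, each of
which is shown to satisfy the defining relations and so extends to an action of `E_N`.

* Braided left multiplication by `e ⊗ 1 + 1 ⊗ e`, that is
  `u ⊗ v ↦ e u ⊗ v + |e|.u ⊗ e v`, acts on `E_N ⊗ E_N`; the coproduct is the orbit map of `1 ⊗ 1`
  (`comulHom`, `fkComul`). No ring structure on `E_N ⊗ E_N` is needed: that the coproduct is
  multiplicative for the braided product comes down to `comulOp_braidedMul`, and coassociativity
  to the corresponding operators on the triple tensor product.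
* The operators `y ↦ -(|e|.y) e` give the antipode in the same way (`antipodeHom`, `fkAntipode`).
* The skew derivations `∂_e y = ⟨e, y₁⟩ y₂` satisfy
  `∂_e (f y) = ⟨e, f⟩ y + f ∂_{|f|⁻¹.e} y` for symbols `f`. This rule shows, by induction on words,
  that they satisfy the defining relations (`skewDer_sq`, `skewDer_comm`, `skewDer_tri`), so
  `x ↦ ∂_x` is an algebra map `E_N → End E_N`, and the pairing is `⟨x, y⟩ = ε(∂_x y)`.

Since each `∂_x` commutes with the right regular coaction (`fkComul_skewDerHom`), one has
`∂_x y = ⟨x, y₁⟩ y₂`, which is the adjointness of product and coproduct in the first argument. In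
the second argument it follows from the Leibniz rule `skewDer_word_mul` together with the fact that
words of degrees `g`, `h` are orthogonal unless `g h = 1`. The antipode is self-adjoint because it
turns `∂_e` into its right-handed version `y ↦ y₁ ⟨e, y₂⟩` (`skewDerRight_fkAntipode`).

On monomials of length `n`, the Leibniz rule for `∂_e` is the recursion
`[n, Ψ] = id + Ψ₁₂ (id ⊗ [n - 1, Ψ])` of the braided integers (`braidedInt_succ`,
`skewDer_fkMonomial`), and iterating it produces the braided factorials.
-/

open scoped TensorProduct
noncomputable section
namespace FominKirillov

variable {k : Type*} [CommRing k] {N : ℕ}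

/-! ### Homogeneous elements and induction over words -/

/-- The transposition `(ij)`, the `S_N`-degree of the symbol `[ij]`. -/
def OrdPair.swap (p : OrdPair N) : Equiv.Perm (Fin N) := Equiv.swap p.1.1 p.1.2

/-- The label of `[ji]`. -/
def OrdPair.rev (p : OrdPair N) : OrdPair N := ⟨(p.1.2, p.1.1), p.2.symm⟩

@[simp] lemma OrdPair.swap_mul_swap (p : OrdPair N) : p.swap * p.swap = 1 :=
  Equiv.swap_mul_self _ _

@[simp] lemma OrdPair.swap_inv (p : OrdPair N) : p.swap⁻¹ = p.swap := Equiv.swap_inv _ _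

lemma OrdPair.swap_perm (g : Equiv.Perm (Fin N)) (p : OrdPair N) :
    (p.perm g).swap = g * p.swap * g⁻¹ := by
  simp [OrdPair.swap, OrdPair.perm, Equiv.swap_apply_apply]

@[simp] lemma OrdPair.perm_one (p : OrdPair N) : p.perm 1 = p := rfl

lemma OrdPair.perm_mul (g h : Equiv.Perm (Fin N)) (p : OrdPair N) :
    p.perm (g * h) = (p.perm h).perm g := rfl

lemma OrdPair.rev_perm (g : Equiv.Perm (Fin N)) (p : OrdPair N) :
    p.rev.perm g = (p.perm g).rev := rfl

@[simp] lemma OrdPair.rev_rev (p : OrdPair N) : p.rev.rev = p := rfl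

@[simp] lemma OrdPair.swap_rev (p : OrdPair N) : p.rev.swap = p.swap := Equiv.swap_comm _ _

lemma OrdPair.perm_swap_self (p : OrdPair N) : p.perm p.swap = p.rev := by
  simp [OrdPair.perm, OrdPair.swap, OrdPair.rev]

lemma br_rev (p : OrdPair N) : br k p.rev = -br k p := by
  rw [eq_neg_iff_add_eq_zero, add_comm, ← eq_neg_iff_add_eq_zero]
  exact br_antisymm _ _ p.2

lemma crossed_act (g : Equiv.Perm (Fin N)) (x : FK k N) :
    (crossed k N).act g x = actHom g x := rfl

lemma crossed_coact (x : FK k N) : (crossed k N).coact x = coactHom (k := k) x := rfl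

@[simp] lemma actHom_one_apply (x : FK k N) : actHom (1 : Equiv.Perm (Fin N)) x = x :=
  LinearMap.congr_fun (map_one (crossed k N).act) x

lemma actHom_mul_apply (g h : Equiv.Perm (Fin N)) (x : FK k N) :
    actHom (g * h) x = actHom g (actHom h x) :=
  LinearMap.congr_fun (map_mul (crossed k N).act g h) x

@[simp] lemma actHom_swap_swap (p : OrdPair N) (x : FK k N) :
    actHom p.swap (actHom p.swap x) = x := by
  rw [← actHom_mul_apply, p.swap_mul_swap, actHom_one_apply]

/-- `x` is homogeneous of degree `g` for the `S_N`-grading. -/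
def IsHomog (g : Equiv.Perm (Fin N)) (x : FK k N) : Prop :=
  coactHom (k := k) x = MonoidAlgebra.single g 1 ⊗ₜ x

namespace IsHomog

variable {g h : Equiv.Perm (Fin N)} {x y : FK k N}

lemma one : IsHomog 1 (1 : FK k N) := by
  simp [IsHomog, MonoidAlgebra.one_def, Algebra.TensorProduct.one_def]

lemma br (p : OrdPair N) : IsHomog p.swap (br k p) := coactHom_br p

lemma mul (hx : IsHomog g x) (hy : IsHomog h y) : IsHomog (g * h) (x * y) := by
  unfold IsHomog at *
  rw [map_mul, hx, hy, Algebra.TensorProduct.tmul_mul_tmul, MonoidAlgebra.single_mul_single,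
    one_mul]

lemma act (f : Equiv.Perm (Fin N)) (hx : IsHomog g x) : IsHomog (f * g * f⁻¹) (actHom f x) := by
  unfold IsHomog at *
  have := (crossed k N).coact_act f x
  rw [crossed_act, crossed_coact, crossed_coact, hx] at this
  rw [this]
  simp [crossed_act]

end IsHomog

lemma span_words :
    Submodule.span k (Set.range fun l : List (OrdPair N) => (l.map (br k)).prod) = ⊤ := by
  rw [eq_top_iff]
  rintro x -
  obtain ⟨y, rfl⟩ := fkMk_surjective x
  induction y using FreeAlgebra.induction with
  | grade0 r =>
    rw [AlgHom.commutes, Algebra.algebraMap_eq_smul_one]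
    exact Submodule.smul_mem _ _ (Submodule.subset_span ⟨[], rfl⟩)
  | grade1 p => exact Submodule.subset_span ⟨[p], by simp [br]⟩
  | add a b ha hb => rw [map_add]; exact Submodule.add_mem _ ha hb
  | mul a b ha hb =>
    rw [map_mul]
    have h := Submodule.mul_mem_mul ha hb
    rw [Submodule.span_mul_span] at h
    refine Submodule.span_mono ?_ h
    rintro _ ⟨_, ⟨l, rfl⟩, _, ⟨l', rfl⟩, rfl⟩
    exact ⟨l ++ l', by simp⟩

/-- `x` is a word in the symbols `[ij]`, and `g` is the product of the corresponding
transpositions. -/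
inductive IsWord : Equiv.Perm (Fin N) → FK k N → Prop
  | one : IsWord 1 1
  | mul (p : OrdPair N) {g : Equiv.Perm (Fin N)} {x : FK k N} (hx : IsWord g x) :
      IsWord (p.swap * g) (br k p * x)

lemma IsWord.isHomog {g : Equiv.Perm (Fin N)} {x : FK k N} (hx : IsWord g x) : IsHomog g x := by
  induction hx with
  | one => exact .one
  | mul p _ ih => exact (IsHomog.br p).mul ih

lemma IsWord.br (p : OrdPair N) : IsWord p.swap (br k p) := by
  simpa using IsWord.mul p (IsWord.one (k := k))

/-- Words span, so linear statements can be checked on words. -/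
@[elab_as_elim]
theorem word_induction {P : FK k N → Prop} (x : FK k N) (word : ∀ x g, IsWord g x → P x)
    (add : ∀ x y, P x → P y → P (x + y)) (smul : ∀ (c : k) x, P x → P (c • x)) : P x := by
  have hx : x ∈ Submodule.span k (Set.range fun l : List (OrdPair N) => (l.map (br k)).prod) := by
    rw [span_words]; trivial
  induction hx using Submodule.span_induction with
  | mem x h =>
    obtain ⟨l, rfl⟩ := h
    suffices h : ∃ g, IsWord g (l.map (FominKirillov.br k)).prod from word _ _ h.choose_spec
    induction l with
    | nil => exact ⟨1, by simpa using IsWord.one⟩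
    | cons p l ih =>
      obtain ⟨g, hg⟩ := ih
      exact ⟨_, by simpa using hg.mul p⟩
  | zero => simpa using smul 0 1 (word 1 1 .one)
  | add x y _ _ hx hy => exact add x y hx hy
  | smul c x _ hx => exact smul c x hx

/-- Induction over words, multiplying by symbols on the left. -/
@[elab_as_elim]
theorem fk_induction {P : FK k N → Prop} (x : FK k N) (one : P 1)
    (mul : ∀ p x g, IsWord g x → P x → P (br k p * x))
    (add : ∀ x y, P x → P y → P (x + y)) (smul : ∀ (c : k) x, P x → P (c • x)) : P x := by
  refine word_induction x (fun x g hx => ?_) add smul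
  induction hx with
  | one => exact one
  | mul p hx ih => exact mul p _ _ hx ih

/-- Induction over words, multiplying by symbols on the right. -/
@[elab_as_elim]
theorem fk_induction_right {P : FK k N → Prop} (x : FK k N) (one : P 1)
    (mul : ∀ p x, P x → P (x * br k p))
    (add : ∀ x y, P x → P y → P (x + y)) (smul : ∀ (c : k) x, P x → P (c • x)) : P x := by
  have hw : ∀ l : List (OrdPair N), P (l.map (br k)).prod := by
    intro l
    induction l using List.reverseRecOn with
    | nil => simpa using one
    | append_singleton l p ih => simpa using mul p _ ih
  have hx : x ∈ Submodule.span k (Set.range fun l : List (OrdPair N) => (l.map (br k)).prod) := by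
    rw [span_words]; trivial
  induction hx using Submodule.span_induction with
  | mem x h => obtain ⟨l, rfl⟩ := h; exact hw l
  | zero => simpa using smul 0 1 one
  | add x y _ _ hx hy => exact add x y hx hy
  | smul c x _ hx => exact smul c x hx

/-! ### The braiding on homogeneous elements -/

lemma braidedMul_tmul {h : Equiv.Perm (Fin N)} {v : FK k N} (hv : IsHomog h v) (u w z : FK k N) :
    braidedMul (crossed k N) ((u ⊗ₜ v) ⊗ₜ (w ⊗ₜ z)) = (u * actHom h w) ⊗ₜ (v * z) := by
  unfold IsHomog at hv
  simp [braidedMul, CrossedModule.braid, crossed_coact, hv, crossed_act]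

lemma tensorCoact_tmul {g h : Equiv.Perm (Fin N)} {u v : FK k N} (hu : IsHomog g u)
    (hv : IsHomog h v) : (crossed k N).tensorCoact (crossed k N) (u ⊗ₜ v) =
      MonoidAlgebra.single (g * h) 1 ⊗ₜ (u ⊗ₜ v) := by
  unfold IsHomog at hu hv
  simp [CrossedModule.tensorCoact, crossed_coact, hu, hv, MonoidAlgebra.single_mul_single]

/-! ### The coproduct -/

/-- Braided left multiplication by the primitive element `[ij] ⊗ 1 + 1 ⊗ [ij]` of `E_N ⊗ E_N`. -/
def comulOp (p : OrdPair N) : Module.End k (FK k N ⊗[k] FK k N) :=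
  TensorProduct.map (LinearMap.mulLeft k (br k p)) LinearMap.id +
    TensorProduct.map (actHom p.swap).toLinearMap (LinearMap.mulLeft k (br k p))

@[simp] lemma comulOp_tmul (p : OrdPair N) (u v : FK k N) :
    comulOp p (u ⊗ₜ v) = (br k p * u) ⊗ₜ v + actHom p.swap u ⊗ₜ (br k p * v) := rfl

/-- The middle terms carry the braiding of the two symbols: the relations hold for the operators
because they are killed by `id + Ψ`. -/
lemma comulOp_comulOp_tmul (p q : OrdPair N) (u v : FK k N) :
    comulOp p (comulOp q (u ⊗ₜ v)) = (br k p * br k q * u) ⊗ₜ v +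
      (br k p * actHom q.swap u) ⊗ₜ (br k q * v) +
      (br k (q.perm p.swap) * actHom p.swap u) ⊗ₜ (br k p * v) +
      actHom (p.swap * q.swap) u ⊗ₜ (br k p * br k q * v) := by
  simp only [comulOp_tmul, map_add, map_mul, actHom_br, actHom_mul_apply, mul_assoc]
  abel

lemma swap_mul_swap_of_disjoint {i j l m : Fin N} (hil : i ≠ l) (him : i ≠ m)
    (hjl : j ≠ l) (hjm : j ≠ m) :
    Equiv.swap i j * Equiv.swap l m = Equiv.swap l m * Equiv.swap i j := by
  rw [Equiv.mul_swap_eq_swap_mul, Equiv.swap_apply_of_ne_of_ne hil.symm hjl.symm,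
    Equiv.swap_apply_of_ne_of_ne him.symm hjm.symm]

/-- The three terms of the three-term relation have the same degree. -/
lemma swap_mul_swap_rotate {i j l : Fin N} (hij : i ≠ j) (hli : l ≠ i) :
    Equiv.swap j l * Equiv.swap l i = Equiv.swap i j * Equiv.swap j l := by
  rw [Equiv.mul_swap_eq_swap_mul, Equiv.swap_apply_right,
    Equiv.swap_apply_of_ne_of_ne hij hli.symm, Equiv.swap_comm j i]

variable (k N) in
/-- `E_N` acts on `E_N ⊗ E_N` by braided left multiplication with the coproduct. -/
def comulHom : FK k N →ₐ[k] Module.End k (FK k N ⊗[k] FK k N) :=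
  fkLift (FreeAlgebra.lift k comulOp) <| by
    intro x y h
    induction h with
    | antisymm i j h =>
      simp only [fkSym, map_neg, FreeAlgebra.lift_ι_apply]
      ext u v
      simp [OrdPair.swap, br_antisymm i j h, Equiv.swap_comm i j, TensorProduct.tmul_neg,
        TensorProduct.neg_tmul]
      abel
    | sq i j h =>
      simp only [fkSym, map_mul, map_zero, FreeAlgebra.lift_ι_apply]
      ext u v
      simp only [TensorProduct.AlgebraTensorModule.curry_apply, TensorProduct.curry_apply,
        LinearMap.restrictScalars_self, Module.End.mul_apply, comulOp_comulOp_tmul,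
        LinearMap.zero_apply]
      simp [br_sq, OrdPair.perm_swap_self, br_rev, TensorProduct.neg_tmul]
    | comm i j l m hij hlm hil him hjl hjm =>
      simp only [fkSym, map_mul, FreeAlgebra.lift_ι_apply]
      ext u v
      simp only [TensorProduct.AlgebraTensorModule.curry_apply, TensorProduct.curry_apply,
        LinearMap.restrictScalars_self, Module.End.mul_apply, comulOp_comulOp_tmul]
      simp only [OrdPair.perm, OrdPair.swap, swap_mul_swap_of_disjoint hil him hjl hjm,
        br_comm i j l m hij hlm hil him hjl hjm, Equiv.swap_apply_of_ne_of_ne hil him,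
        Equiv.swap_apply_of_ne_of_ne hjl hjm, Equiv.swap_apply_of_ne_of_ne hil.symm hjl.symm,
        Equiv.swap_apply_of_ne_of_ne him.symm hjm.symm]
      abel
    | tri i j l hij hjl hli =>
      simp only [fkSym, map_mul, map_add, map_zero, FreeAlgebra.lift_ι_apply]
      ext u v
      simp only [TensorProduct.AlgebraTensorModule.curry_apply, TensorProduct.curry_apply,
        LinearMap.restrictScalars_self, Module.End.mul_apply, comulOp_comulOp_tmul,
        LinearMap.zero_apply, LinearMap.add_apply]
      have h3 := br_tri (k := k) i j l hij hjl hli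
      simp only [OrdPair.perm, OrdPair.swap, swap_mul_swap_rotate hij hli,
        swap_mul_swap_rotate hjl hij,
        Equiv.swap_apply_right, Equiv.swap_apply_of_ne_of_ne hij hli.symm,
        Equiv.swap_apply_of_ne_of_ne hjl hij.symm, Equiv.swap_apply_of_ne_of_ne hli hjl.symm,
        br_antisymm i l hli.symm, br_antisymm j i hij.symm, br_antisymm l j hjl.symm,
        neg_mul, TensorProduct.neg_tmul]
      -- The mixed terms cancel in pairs; the outer ones are two copies of the three-term relation.
      have e1 := congrArg (fun t => (t * u) ⊗ₜ[k] v) h3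
      have e2 := congrArg (fun t => actHom (Equiv.swap i j * Equiv.swap j l) u ⊗ₜ[k] (t * v)) h3
      simp only [add_mul, TensorProduct.add_tmul, TensorProduct.tmul_add, zero_mul,
        TensorProduct.zero_tmul, TensorProduct.tmul_zero] at e1 e2
      rw [← add_zero (0 : FK k N ⊗[k] FK k N)]
      nth_rewrite 1 [← e1]
      rw [← e2]
      abel

variable (k N) in
/-- The braided coproduct of `E_N`. -/
def fkComul : FK k N →ₗ[k] FK k N ⊗[k] FK k N :=
  (LinearMap.applyₗ (1 ⊗ₜ 1)) ∘ₗ (comulHom k N).toLinearMap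

lemma comulHom_br (p : OrdPair N) : comulHom k N (br k p) = comulOp p := by
  simp [comulHom, br, fkLift_mk]

@[simp] lemma fkComul_one : fkComul k N 1 = 1 ⊗ₜ 1 := by simp [fkComul]

@[simp] lemma fkComul_br_mul (p : OrdPair N) (x : FK k N) :
    fkComul k N (br k p * x) = comulOp p (fkComul k N x) := by
  simp [fkComul, comulHom_br]

@[simp] lemma fkComul_br (p : OrdPair N) :
    fkComul k N (br k p) = br k p ⊗ₜ 1 + 1 ⊗ₜ br k p := by
  simpa using fkComul_br_mul (k := k) p 1

/-- Linear statements on `E_N ⊗ E_N` can be checked on pairs of words. -/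
@[elab_as_elim]
theorem tensor_word_induction {P : FK k N ⊗[k] FK k N → Prop} (t : FK k N ⊗[k] FK k N)
    (tmul : ∀ u v g h, IsWord g u → IsWord h v → P (u ⊗ₜ v))
    (add : ∀ x y, P x → P y → P (x + y)) (smul : ∀ (c : k) x, P x → P (c • x)) : P t := by
  induction t using TensorProduct.induction_on with
  | zero => simpa using smul 0 _ (tmul 1 1 1 1 .one .one)
  | add x y hx hy => exact add x y hx hy
  | tmul u v =>
    induction u using word_induction with
    | word u g hu =>
      induction v using word_induction with
      | word v h hv => exact tmul u v g h hu hv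
      | add x y hx hy => rw [TensorProduct.tmul_add]; exact add _ _ hx hy
      | smul c x hx => rw [TensorProduct.tmul_smul]; exact smul _ _ hx
    | add x y hx hy => rw [TensorProduct.add_tmul]; exact add _ _ hx hy
    | smul c x hx => rw [← TensorProduct.smul_tmul']; exact smul _ _ hx

/-- The associativity of the braided tensor product algebra that makes the coproduct
multiplicative. -/
lemma comulOp_braidedMul (p : OrdPair N) (s t : FK k N ⊗[k] FK k N) :
    comulOp p (braidedMul (crossed k N) (s ⊗ₜ t)) =
      braidedMul (crossed k N) (comulOp p s ⊗ₜ t) := by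
  induction s using tensor_word_induction with
  | tmul u v g h hu hv =>
    replace hu := hu.isHomog
    replace hv := hv.isHomog
    induction t using TensorProduct.induction_on with
    | zero => simp
    | tmul w z =>
      rw [comulOp_tmul, TensorProduct.add_tmul, map_add, braidedMul_tmul hv, braidedMul_tmul hv,
        braidedMul_tmul ((IsHomog.br p).mul hv), comulOp_tmul, map_mul, actHom_mul_apply,
        mul_assoc, mul_assoc]
    | add x y hx hy => simp only [TensorProduct.tmul_add, map_add, hx, hy]
  | add x y hx hy => simp only [TensorProduct.add_tmul, map_add, hx, hy]
  | smul c x hx => simp only [← TensorProduct.smul_tmul', map_smul, hx]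

theorem fkComul_mul (x y : FK k N) :
    fkComul k N (x * y) = braidedMul (crossed k N) (fkComul k N x ⊗ₜ fkComul k N y) := by
  induction x using fk_induction with
  | one =>
    rw [one_mul, fkComul_one]
    induction fkComul k N y using TensorProduct.induction_on with
    | zero => simp
    | tmul w z => simp [braidedMul_tmul IsHomog.one]
    | add x y hx hy => rw [TensorProduct.tmul_add, map_add, ← hx, ← hy]
  | mul p x g _ ih => rw [mul_assoc, fkComul_br_mul, fkComul_br_mul, ih, comulOp_braidedMul]
  | add x x' h h' => simp only [add_mul, map_add, TensorProduct.add_tmul, h, h']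
  | smul c x h => simp only [smul_mul_assoc, map_smul, ← TensorProduct.smul_tmul', h]

lemma comulOp_act (g : Equiv.Perm (Fin N)) (p : OrdPair N) (t : FK k N ⊗[k] FK k N) :
    comulOp (p.perm g) (TensorProduct.map (actHom g).toLinearMap (actHom g).toLinearMap t) =
      TensorProduct.map (actHom g).toLinearMap (actHom g).toLinearMap (comulOp p t) := by
  induction t using TensorProduct.induction_on with
  | zero => simp
  | tmul u v => simp [OrdPair.swap_perm, ← actHom_mul_apply]
  | add x y hx hy => simp only [map_add, hx, hy]

theorem fkComul_act (g : Equiv.Perm (Fin N)) (x : FK k N) : fkComul k N (actHom g x) =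
    TensorProduct.map (actHom g).toLinearMap (actHom g).toLinearMap (fkComul k N x) := by
  induction x using fk_induction with
  | one => simp
  | mul p x _ _ ih => rw [map_mul, actHom_br, fkComul_br_mul, fkComul_br_mul, ih, comulOp_act]
  | add x y hx hy => simp only [map_add, hx, hy]
  | smul c x hx => simp only [map_smul, hx]

lemma tensorCoact_comulOp (p : OrdPair N) (t : FK k N ⊗[k] FK k N) :
    (crossed k N).tensorCoact (crossed k N) (comulOp p t) =
      TensorProduct.map (LinearMap.mulLeft k (MonoidAlgebra.single p.swap 1)) (comulOp p)
        ((crossed k N).tensorCoact (crossed k N) t) := by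
  induction t using tensor_word_induction with
  | tmul u v g h hu hv =>
    replace hu := hu.isHomog
    replace hv := hv.isHomog
    rw [comulOp_tmul, map_add, tensorCoact_tmul ((IsHomog.br p).mul hu) hv,
      tensorCoact_tmul (hu.act p.swap) ((IsHomog.br p).mul hv), tensorCoact_tmul hu hv]
    simp [MonoidAlgebra.single_mul_single, TensorProduct.tmul_add, mul_assoc,
      ← mul_assoc p.swap p.swap]
  | add x y hx hy => simp only [map_add, hx, hy]
  | smul c x hx => simp only [map_smul, hx]

theorem tensorCoact_fkComul (x : FK k N) :
    (crossed k N).tensorCoact (crossed k N) (fkComul k N x) =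
      (fkComul k N).lTensor (MonoidAlgebra k (Equiv.Perm (Fin N))) (coactHom (k := k) x) := by
  induction x using fk_induction with
  | one =>
    rw [fkComul_one, tensorCoact_tmul .one .one, map_one, Algebra.TensorProduct.one_def]
    simp [MonoidAlgebra.one_def]
  | mul p x g hg ih =>
    replace hg := hg.isHomog
    rw [fkComul_br_mul, tensorCoact_comulOp, ih, hg, ((IsHomog.br p).mul hg)]
    simp [MonoidAlgebra.single_mul_single]
  | add x y hx hy => simp only [map_add, hx, hy]
  | smul c x hx => simp only [map_smul, hx]

/-! ### The counit and the coalgebra axioms -/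

variable (k N) in
/-- The counit of `E_N`, the algebra map killing all symbols `[ij]`. -/
def fkCounit : FK k N →ₐ[k] k :=
  fkLift (FreeAlgebra.lift k fun _ => 0) fun x y h => by cases h <;> simp [fkSym]

@[simp] lemma fkCounit_br (p : OrdPair N) : fkCounit k N (br k p) = 0 := by
  simp [fkCounit, br, fkLift_mk]

@[simp] lemma fkCounit_act (g : Equiv.Perm (Fin N)) (x : FK k N) :
    fkCounit k N (actHom g x) = fkCounit k N x := by
  have : (fkCounit k N).comp (actHom g) = fkCounit k N := fkHom_ext fun p => by simp
  exact congrArg (fun f => f x) this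

theorem counit_coact (x : FK k N) :
    (fkCounit k N).toLinearMap.lTensor (MonoidAlgebra k (Equiv.Perm (Fin N)))
      (coactHom (k := k) x) = 1 ⊗ₜ fkCounit k N x := by
  have : (Algebra.TensorProduct.map (AlgHom.id k (MonoidAlgebra k (Equiv.Perm (Fin N))))
      (fkCounit k N)).comp coactHom =
      Algebra.TensorProduct.includeRight.comp (fkCounit k N) := fkHom_ext fun p => by simp
  exact congrArg (fun f => f x) this

theorem counit_rTensor_fkComul (x : FK k N) :
    (fkCounit k N).toLinearMap.rTensor (FK k N) (fkComul k N x) = 1 ⊗ₜ x := by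
  induction x using fk_induction with
  | one => simp
  | mul p x _ _ ih =>
    have key : ∀ t, (fkCounit k N).toLinearMap.rTensor (FK k N) (comulOp p t) =
        (LinearMap.mulLeft k (br k p)).lTensor k
          ((fkCounit k N).toLinearMap.rTensor (FK k N) t) := by
      intro t
      induction t using TensorProduct.induction_on with
      | zero => simp
      | tmul u v => simp
      | add x y hx hy => simp only [map_add, hx, hy]
    rw [fkComul_br_mul, key, ih]
    simp
  | add x y hx hy => simp only [map_add, TensorProduct.tmul_add, hx, hy]
  | smul c x hx => simp only [map_smul, TensorProduct.tmul_smul, hx]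

theorem counit_lTensor_fkComul (x : FK k N) :
    (fkCounit k N).toLinearMap.lTensor (FK k N) (fkComul k N x) = x ⊗ₜ 1 := by
  induction x using fk_induction with
  | one => simp
  | mul p x _ _ ih =>
    have key : ∀ t, (fkCounit k N).toLinearMap.lTensor (FK k N) (comulOp p t) =
        (LinearMap.mulLeft k (br k p)).rTensor k
          ((fkCounit k N).toLinearMap.lTensor (FK k N) t) := by
      intro t
      induction t using TensorProduct.induction_on with
      | zero => simp
      | tmul u v => simp
      | add x y hx hy => simp only [map_add, hx, hy]
    rw [fkComul_br_mul, key, ih]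
    simp
  | add x y hx hy => simp only [map_add, TensorProduct.add_tmul, hx, hy]
  | smul c x hx => simp only [map_smul, TensorProduct.smul_tmul', hx]

/-- Braided left multiplication by `[ij] ⊗ 1 ⊗ 1 + 1 ⊗ [ij] ⊗ 1 + 1 ⊗ 1 ⊗ [ij]`. -/
def comulOp₃ (p : OrdPair N) : Module.End k (FK k N ⊗[k] (FK k N ⊗[k] FK k N)) :=
  TensorProduct.map (LinearMap.mulLeft k (br k p)) LinearMap.id +
    TensorProduct.map (actHom p.swap).toLinearMap (comulOp p)

@[simp] lemma comulOp₃_tmul (p : OrdPair N) (u : FK k N) (t : FK k N ⊗[k] FK k N) :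
    comulOp₃ p (u ⊗ₜ t) = (br k p * u) ⊗ₜ t + actHom p.swap u ⊗ₜ comulOp p t := rfl

lemma lTensor_comulOp (p : OrdPair N) (t : FK k N ⊗[k] FK k N) :
    (fkComul k N).lTensor (FK k N) (comulOp p t) =
      comulOp₃ p ((fkComul k N).lTensor (FK k N) t) := by
  induction t using TensorProduct.induction_on with
  | zero => simp
  | tmul u v => simp
  | add x y hx hy => simp only [map_add, hx, hy]

lemma assoc_rTensor_comulOp (p : OrdPair N) (t : FK k N ⊗[k] FK k N) :
    TensorProduct.assoc k (FK k N) (FK k N) (FK k N)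
        ((fkComul k N).rTensor (FK k N) (comulOp p t)) =
      comulOp₃ p (TensorProduct.assoc k (FK k N) (FK k N) (FK k N)
        ((fkComul k N).rTensor (FK k N) t)) := by
  induction t using TensorProduct.induction_on with
  | zero => simp
  | tmul u v =>
    simp only [comulOp_tmul, map_add, LinearMap.rTensor_tmul, fkComul_br_mul, fkComul_act]
    induction fkComul k N u using TensorProduct.induction_on with
    | zero => simp
    | tmul a b => simp [TensorProduct.add_tmul, TensorProduct.tmul_add, add_assoc]
    | add x y hx hy =>
      simp only [map_add, TensorProduct.add_tmul, ← hx, ← hy]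
      abel
  | add x y hx hy => simp only [map_add, hx, hy]

theorem fkComul_coassoc (x : FK k N) :
    TensorProduct.assoc k (FK k N) (FK k N) (FK k N)
      ((fkComul k N).rTensor (FK k N) (fkComul k N x)) =
      (fkComul k N).lTensor (FK k N) (fkComul k N x) := by
  induction x using fk_induction with
  | one => simp
  | mul p x _ _ ih => rw [fkComul_br_mul, assoc_rTensor_comulOp, lTensor_comulOp, ih]
  | add x y hx hy => simp only [map_add, hx, hy]
  | smul c x hx => simp only [map_smul, hx]

/-! ### The antipode -/

/-- The operator `y ↦ -(ij).y [ij]`, which is `S([ij] x)` for `y = S x`. -/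
def antipodeOp (p : OrdPair N) : Module.End k (FK k N) :=
  -(LinearMap.mulRight k (br k p) ∘ₗ (actHom p.swap).toLinearMap)

@[simp] lemma antipodeOp_apply (p : OrdPair N) (y : FK k N) :
    antipodeOp p y = -(actHom p.swap y * br k p) := rfl

lemma antipodeOp_antipodeOp (p q : OrdPair N) (y : FK k N) :
    antipodeOp p (antipodeOp q y) =
      actHom (p.swap * q.swap) y * (br k (q.perm p.swap) * br k p) := by
  simp [actHom_mul_apply, mul_assoc]

variable (k N) in
/-- The operators `antipodeOp` satisfy the defining relations of `E_N`. -/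
def antipodeHom : FK k N →ₐ[k] Module.End k (FK k N) :=
  fkLift (FreeAlgebra.lift k antipodeOp) <| by
    intro x y h
    induction h with
    | antisymm i j h =>
      ext y
      simp [fkSym, OrdPair.swap, br_antisymm i j h, Equiv.swap_comm i j]
    | sq i j h =>
      ext y
      simp only [fkSym, map_mul, map_zero, FreeAlgebra.lift_ι_apply, Module.End.mul_apply,
        antipodeOp_antipodeOp]
      simp [OrdPair.perm_swap_self, br_rev, br_sq]
    | comm i j l m hij hlm hil him hjl hjm =>
      ext y
      simp only [fkSym, map_mul, FreeAlgebra.lift_ι_apply, Module.End.mul_apply,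
        antipodeOp_antipodeOp]
      simp only [OrdPair.perm, OrdPair.swap, swap_mul_swap_of_disjoint hil him hjl hjm,
        br_comm i j l m hij hlm hil him hjl hjm, Equiv.swap_apply_of_ne_of_ne hil him,
        Equiv.swap_apply_of_ne_of_ne hjl hjm, Equiv.swap_apply_of_ne_of_ne hil.symm hjl.symm,
        Equiv.swap_apply_of_ne_of_ne him.symm hjm.symm]
    | tri i j l hij hjl hli =>
      ext y
      simp only [fkSym, map_mul, map_add, map_zero, FreeAlgebra.lift_ι_apply,
        Module.End.mul_apply, antipodeOp_antipodeOp, LinearMap.zero_apply, LinearMap.add_apply]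
      simp only [OrdPair.perm, OrdPair.swap, swap_mul_swap_rotate hij hli,
        swap_mul_swap_rotate hjl hij,
        Equiv.swap_apply_right, Equiv.swap_apply_of_ne_of_ne hij hli.symm,
        Equiv.swap_apply_of_ne_of_ne hjl hij.symm, Equiv.swap_apply_of_ne_of_ne hli hjl.symm,
        br_antisymm i l hli.symm, br_antisymm j i hij.symm, br_antisymm l j hjl.symm, neg_mul,
        ← mul_add, ← neg_add]
      have h3 := br_tri (k := k) i j l hij hjl hli
      have h4 : br k ⟨(l, i), hli⟩ * br k ⟨(i, j), hij⟩ + br k ⟨(i, j), hij⟩ * br k ⟨(j, l), hjl⟩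
          + br k ⟨(j, l), hjl⟩ * br k ⟨(l, i), hli⟩ = 0 := by
        rw [← h3]; abel
      rw [h4, neg_zero, mul_zero]

variable (k N) in
/-- The braided antipode of `E_N`. -/
def fkAntipode : FK k N →ₗ[k] FK k N :=
  (LinearMap.applyₗ 1) ∘ₗ (antipodeHom k N).toLinearMap

@[simp] lemma fkAntipode_one : fkAntipode k N 1 = 1 := by simp [fkAntipode]

@[simp] lemma fkAntipode_br_mul (p : OrdPair N) (x : FK k N) :
    fkAntipode k N (br k p * x) = -(actHom p.swap (fkAntipode k N x) * br k p) := by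
  have : antipodeHom k N (br k p) = antipodeOp p := by simp [antipodeHom, br, fkLift_mk]
  simp [fkAntipode, this]

theorem fkAntipode_act (g : Equiv.Perm (Fin N)) (x : FK k N) :
    fkAntipode k N (actHom g x) = actHom g (fkAntipode k N x) := by
  induction x using fk_induction with
  | one => simp
  | mul p x _ _ ih =>
    rw [map_mul, actHom_br, fkAntipode_br_mul, fkAntipode_br_mul, ih]
    simp [OrdPair.swap_perm, ← actHom_mul_apply]
  | add x y hx hy => simp only [map_add, hx, hy]
  | smul c x hx => simp only [map_smul, hx]

theorem coact_fkAntipode (x : FK k N) : coactHom (k := k) (fkAntipode k N x) =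
    (fkAntipode k N).lTensor (MonoidAlgebra k (Equiv.Perm (Fin N))) (coactHom (k := k) x) := by
  induction x using fk_induction with
  | one => simp [Algebra.TensorProduct.one_def]
  | mul p x g hg ih =>
    replace hg := hg.isHomog
    have hS : IsHomog g (fkAntipode k N x) := by rw [IsHomog, ih, hg]; simp
    rw [((IsHomog.br p).mul hg), fkAntipode_br_mul, map_neg,
      ((hS.act p.swap).mul (IsHomog.br p))]
    simp [mul_assoc, TensorProduct.tmul_neg]
  | add x y hx hy => simp only [map_add, hx, hy]
  | smul c x hx => simp only [map_smul, hx]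

theorem mul_antipode_left (x : FK k N) :
    LinearMap.mul' k (FK k N) ((fkAntipode k N).rTensor (FK k N) (fkComul k N x)) =
      algebraMap k (FK k N) (fkCounit k N x) := by
  induction x using fk_induction with
  | one => simp
  | mul p x _ _ ih =>
    -- `S(e u) v + S(|e|.u) e v = 0` holds already before summing over the coproduct.
    have key : ∀ t, LinearMap.mul' k (FK k N)
        ((fkAntipode k N).rTensor (FK k N) (comulOp p t)) = 0 := by
      intro t
      induction t using TensorProduct.induction_on with
      | zero => simp
      | tmul u v => simp [mul_assoc, fkAntipode_act]
      | add x y hx hy => simp only [map_add, hx, hy, add_zero]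
    rw [fkComul_br_mul, key]
    simp
  | add x y hx hy => simp only [map_add, hx, hy]
  | smul c x hx => rw [map_smul, map_smul, map_smul, hx]; simp [Algebra.smul_def]

theorem mul_antipode_right (x : FK k N) :
    LinearMap.mul' k (FK k N) ((fkAntipode k N).lTensor (FK k N) (fkComul k N x)) =
      algebraMap k (FK k N) (fkCounit k N x) := by
  induction x using fk_induction with
  | one => simp
  | mul p x _ _ ih =>
    -- Here the two terms become a braided commutator with `u S(v)`, which vanishes on scalars.
    have key : ∀ t, LinearMap.mul' k (FK k N)
        ((fkAntipode k N).lTensor (FK k N) (comulOp p t)) =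
          br k p * LinearMap.mul' k (FK k N) ((fkAntipode k N).lTensor (FK k N) t) -
          actHom p.swap (LinearMap.mul' k (FK k N) ((fkAntipode k N).lTensor (FK k N) t)) *
            br k p := by
      intro t
      induction t using TensorProduct.induction_on with
      | zero => simp
      | tmul u v => simp [mul_assoc, sub_eq_add_neg]
      | add x y hx hy =>
        simp only [map_add, hx, hy, mul_add, add_mul]
        abel
    rw [fkComul_br_mul, key, ih]
    simp [Algebra.commutes]
  | add x y hx hy => simp only [map_add, hx, hy]
  | smul c x hx => rw [map_smul, map_smul, map_smul, hx]; simp [Algebra.smul_def]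

variable (k N) in
/-- The braided group structure of `E_N`, with all symbols `[ij]` primitive. -/
def fkBraidedGroup : BraidedGroup (crossed k N) where
  comul := fkComul k N
  counit := (fkCounit k N).toLinearMap
  coassoc := LinearMap.ext fkComul_coassoc
  rTensor_counit_comp_comul := LinearMap.ext counit_rTensor_fkComul
  lTensor_counit_comp_comul := LinearMap.ext counit_lTensor_fkComul
  antipode := fkAntipode k N
  act_one g := map_one (actHom g)
  act_mul g := map_mul (actHom g)
  coact_one := map_one (coactHom (k := k))
  coact_mul := map_mul (coactHom (k := k))
  comul_act := fkComul_act
  comul_coact := tensorCoact_fkComul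
  counit_act := fkCounit_act
  counit_coact := counit_coact
  antipode_act := fkAntipode_act
  antipode_coact := coact_fkAntipode
  counit_one := map_one (fkCounit k N)
  counit_mul := map_mul (fkCounit k N)
  comul_one := fkComul_one
  comul_mul := fkComul_mul
  mul_antipode_left := mul_antipode_left
  mul_antipode_right := mul_antipode_right

/-! ### Skew derivations -/

lemma OrdPair.perm_injective (g : Equiv.Perm (Fin N)) :
    Function.Injective (OrdPair.perm g : OrdPair N → OrdPair N) := fun p q h => by
  simpa [← OrdPair.perm_mul] using congrArg (OrdPair.perm g⁻¹) h

variable (k) in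
/-- The pairing of the symbols with labels `p` and `q`: it is `1` if `p = q`, it is `-1` if the
symbols are opposite to each other, and it is `0` otherwise. -/
def coord (p q : OrdPair N) : k := (if p = q then 1 else 0) - if p = q.rev then 1 else 0

lemma coord_rev_left (p q : OrdPair N) : coord k p.rev q = -coord k p q := by
  have h1 : p.rev = q ↔ p = q.rev :=
    ⟨fun h => by rw [← h, p.rev_rev], fun h => by rw [h, q.rev_rev]⟩
  have h2 : p.rev = q.rev ↔ p = q :=
    ⟨fun h => by rw [← p.rev_rev, h, q.rev_rev], fun h => by rw [h]⟩
  rw [coord, coord, neg_sub]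
  exact congrArg₂ (· - ·) (if_congr h1 rfl rfl) (if_congr h2 rfl rfl)

lemma coord_rev_right (p q : OrdPair N) : coord k p q.rev = -coord k p q := by
  rw [coord, coord, neg_sub]; rfl

@[simp] lemma coord_perm (g : Equiv.Perm (Fin N)) (p q : OrdPair N) :
    coord k (p.perm g) (q.perm g) = coord k p q := by
  simp only [coord, ← OrdPair.rev_perm, (OrdPair.perm_injective g).eq_iff]

lemma coord_perm_left (g : Equiv.Perm (Fin N)) (p q : OrdPair N) :
    coord k p (q.perm g) = coord k (p.perm g⁻¹) q := by
  rw [← coord_perm g⁻¹]; simp [← OrdPair.perm_mul]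

/-- Non-orthogonal symbols have the same degree. -/
lemma coord_eq_zero_or (p q : OrdPair N) : coord k p q = 0 ∨ p.swap = q.swap := by
  by_cases h1 : p = q
  · exact .inr (by rw [h1])
  by_cases h2 : p = q.rev
  · exact .inr (by rw [h2, q.swap_rev])
  · exact .inl (by simp [coord, h1, h2])

/-- The algebra map to the dual numbers whose infinitesimal part is the linear functional
`⟨[ij], ·⟩`. -/
def dualHom (p : OrdPair N) : FK k N →ₐ[k] DualNumber k :=
  fkLift (FreeAlgebra.lift k fun q => TrivSqZeroExt.inr (coord k p q)) fun x y h => by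
    cases h with
    | antisymm i j h =>
      simp only [fkSym, map_neg, FreeAlgebra.lift_ι_apply]
      exact (congrArg _ (coord_rev_right p ⟨(j, i), h.symm⟩)).trans (TrivSqZeroExt.inr_neg _ _)
    | sq => simp [fkSym]
    | comm => simp [fkSym]
    | tri => simp [fkSym]

lemma dualHom_br (p q : OrdPair N) :
    dualHom p (br k q) = TrivSqZeroExt.inr (coord k p q) := by
  simp [dualHom, br, fkLift_mk]

/-- The linear functional `⟨[ij], ·⟩`, which vanishes on words of length other than one. -/
def coordMap (p : OrdPair N) : FK k N →ₗ[k] k :=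
  TrivSqZeroExt.sndHom k k ∘ₗ (dualHom p).toLinearMap

@[simp] lemma coordMap_one (p : OrdPair N) : coordMap p (1 : FK k N) = 0 := by simp [coordMap]

@[simp] lemma coordMap_br_mul (p q : OrdPair N) (x : FK k N) :
    coordMap p (br k q * x) = coord k p q * fkCounit k N x := by
  have : (TrivSqZeroExt.fstHom k k k).comp (dualHom p) = fkCounit k N :=
    fkHom_ext fun q => by simp [dualHom_br]
  have h : (dualHom p x).fst = fkCounit k N x := congrArg (fun f => f x) this
  simp [coordMap, dualHom_br, h]

@[simp] lemma coordMap_rev (p : OrdPair N) : coordMap (k := k) p.rev = -coordMap p := by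
  ext x
  induction x using fk_induction with
  | one => simp
  | mul q x => simp [coord_rev_left]
  | add x y hx hy => simp only [map_add, hx, hy]
  | smul c x hx => simp only [map_smul, hx]

lemma coordMap_act (g : Equiv.Perm (Fin N)) (p : OrdPair N) (x : FK k N) :
    coordMap p (actHom g x) = coordMap (p.perm g⁻¹) x := by
  induction x using fk_induction with
  | one => simp
  | mul q x => simp [coord_perm_left]
  | add x y hx hy => simp only [map_add, hx, hy]
  | smul c x hx => simp only [map_smul, hx]

/-- The skew derivation `y ↦ ⟨[ij], y₁⟩ y₂`. -/
def skewDer (p : OrdPair N) : Module.End k (FK k N) :=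
  (TensorProduct.lid k (FK k N)).toLinearMap ∘ₗ (coordMap p).rTensor (FK k N) ∘ₗ fkComul k N

lemma skewDer_apply (p : OrdPair N) (y : FK k N) : skewDer p y =
    TensorProduct.lid k (FK k N) ((coordMap p).rTensor (FK k N) (fkComul k N y)) := rfl

@[simp] lemma skewDer_one (p : OrdPair N) : skewDer p (1 : FK k N) = 0 := by
  simp [skewDer_apply]

/-- The braided Leibniz rule `∂_e (f y) = ⟨e, f⟩ y + f ∂_{|f|.e} y` for symbols `e`, `f`, where
`|f|⁻¹ = |f|`. -/
@[simp] lemma skewDer_br_mul (p q : OrdPair N) (y : FK k N) : skewDer p (br k q * y) =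
    coord k p q • y + br k q * skewDer (p.perm q.swap) y := by
  have key : ∀ t, TensorProduct.lid k (FK k N) ((coordMap p).rTensor (FK k N) (comulOp q t)) =
      coord k p q • TensorProduct.lid k (FK k N)
        ((fkCounit k N).toLinearMap.rTensor (FK k N) t) +
      br k q * TensorProduct.lid k (FK k N)
        ((coordMap (p.perm q.swap)).rTensor (FK k N) t) := by
    intro t
    induction t using TensorProduct.induction_on with
    | zero => simp
    | tmul u v => simp [coordMap_act, mul_smul]
    | add x y hx hy =>
      simp only [map_add, hx, hy, smul_add, mul_add]
      abel
  rw [skewDer_apply, fkComul_br_mul, key, counit_rTensor_fkComul, skewDer_apply,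
    TensorProduct.lid_tmul, one_smul]

@[simp] lemma skewDer_rev (p : OrdPair N) : skewDer (k := k) p.rev = -skewDer p := by
  ext y
  simp [skewDer_apply, LinearMap.rTensor_neg]

/-- Symbols that pair non-trivially have equal transpositions, so `r` may be replaced by `p`. -/
lemma coord_smul_skewDer_perm (p q r : OrdPair N) (y : FK k N) :
    coord k p r • skewDer (q.perm r.swap) y = coord k p r • skewDer (q.perm p.swap) y := by
  rcases coord_eq_zero_or (k := k) p r with h | h
  · simp [h]
  · rw [h]

lemma skewDer_skewDer_br_mul (p q r : OrdPair N) (y : FK k N) :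
    skewDer p (skewDer q (br k r * y)) =
      coord k q r • skewDer p y + coord k p r • skewDer (q.perm p.swap) y +
        br k r * skewDer (p.perm r.swap) (skewDer (q.perm r.swap) y) := by
  simp only [skewDer_br_mul, map_add, map_smul, coord_smul_skewDer_perm, add_assoc]

lemma skewDer_sq (p : OrdPair N) (y : FK k N) : skewDer p (skewDer p y) = 0 := by
  induction y using fk_induction generalizing p with
  | one => simp
  | mul r y _ _ ih => rw [skewDer_skewDer_br_mul, ih, OrdPair.perm_swap_self]; simp
  | add x y hx hy => simp only [map_add, hx, hy, add_zero]
  | smul c x hx => simp only [map_smul, hx, smul_zero]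

lemma skewDer_comm (i j l m : Fin N) (hij : i ≠ j) (hlm : l ≠ m) (hil : i ≠ l) (him : i ≠ m)
    (hjl : j ≠ l) (hjm : j ≠ m) (y : FK k N) :
    skewDer ⟨(i, j), hij⟩ (skewDer ⟨(l, m), hlm⟩ y) =
      skewDer ⟨(l, m), hlm⟩ (skewDer ⟨(i, j), hij⟩ y) := by
  induction y using fk_induction generalizing i j l m with
  | one => simp
  | mul r y _ _ ih =>
    rw [skewDer_skewDer_br_mul, skewDer_skewDer_br_mul]
    simp only [OrdPair.perm, OrdPair.swap, Equiv.swap_apply_of_ne_of_ne hil him,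
        Equiv.swap_apply_of_ne_of_ne hjl hjm, Equiv.swap_apply_of_ne_of_ne hil.symm hjl.symm,
        Equiv.swap_apply_of_ne_of_ne him.symm hjm.symm]
    rw [ih _ _ _ _ _ _ (by simpa using hil) (by simpa using him) (by simpa using hjl)
      (by simpa using hjm)]
    abel
  | add x y hx hy =>
    simp only [map_add, hx i j l m hij hlm hil him hjl hjm, hy i j l m hij hlm hil him hjl hjm]
  | smul c x hx => simp only [map_smul, hx i j l m hij hlm hil him hjl hjm]

lemma skewDer_tri (i j l : Fin N) (hij : i ≠ j) (hjl : j ≠ l) (hli : l ≠ i) (y : FK k N) :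
    skewDer ⟨(i, j), hij⟩ (skewDer ⟨(j, l), hjl⟩ y) +
      skewDer ⟨(j, l), hjl⟩ (skewDer ⟨(l, i), hli⟩ y) +
      skewDer ⟨(l, i), hli⟩ (skewDer ⟨(i, j), hij⟩ y) = 0 := by
  induction y using fk_induction generalizing i j l with
  | one => simp
  | mul r y _ _ ih =>
    have hneg (a b : Fin N) (h : a ≠ b) :
        skewDer (k := k) ⟨(a, b), h⟩ y = -skewDer ⟨(b, a), h.symm⟩ y := by
      simpa [OrdPair.rev] using LinearMap.congr_fun (skewDer_rev (k := k) ⟨(b, a), h.symm⟩) y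
    have h := congrArg (br k r * ·) (ih (Equiv.swap r.1.1 r.1.2 i) (Equiv.swap r.1.1 r.1.2 j)
      (Equiv.swap r.1.1 r.1.2 l) (by simpa using hij) (by simpa using hjl) (by simpa using hli))
    simp only [mul_add, mul_zero] at h
    simp only [skewDer_skewDer_br_mul, OrdPair.perm, OrdPair.swap, Equiv.swap_apply_right,
      Equiv.swap_apply_of_ne_of_ne hij hli.symm, Equiv.swap_apply_of_ne_of_ne hjl hij.symm,
      Equiv.swap_apply_of_ne_of_ne hli hjl.symm, hneg i l hli.symm, hneg j i hij.symm,
      hneg l j hjl.symm, smul_neg]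
    rw [← h]
    abel
  | add x y hx hy =>
    have h := congrArg₂ (· + ·) (hx i j l hij hjl hli) (hy i j l hij hjl hli)
    simp only [add_zero] at h
    simp only [map_add]
    rw [← h]
    abel
  | smul c x hx => simp only [map_smul, ← smul_add, hx i j l hij hjl hli, smul_zero]

variable (k N) in
/-- The skew derivations satisfy the defining relations of `E_N`, so `E_N` acts on itself by
`x ↦ (y ↦ ⟨x, y₁⟩ y₂)`. -/
def skewDerHom : FK k N →ₐ[k] Module.End k (FK k N) :=
  fkLift (FreeAlgebra.lift k skewDer) <| by
    intro x y h
    induction h with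
    | antisymm i j h =>
      simpa [fkSym, OrdPair.rev] using skewDer_rev (k := k) ⟨(j, i), h.symm⟩
    | sq i j h => ext y; simp [fkSym, skewDer_sq]
    | comm i j l m hij hlm hil him hjl hjm =>
      ext y; simp [fkSym, skewDer_comm i j l m hij hlm hil him hjl hjm]
    | tri i j l hij hjl hli => ext y; simp [fkSym, skewDer_tri i j l hij hjl hli]

@[simp] lemma skewDerHom_br (p : OrdPair N) : skewDerHom k N (br k p) = skewDer p := by
  simp [skewDerHom, br, fkLift_mk]

lemma skewDer_act (g : Equiv.Perm (Fin N)) (p : OrdPair N) (y : FK k N) :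
    skewDer (p.perm g) (actHom g y) = actHom g (skewDer p y) := by
  induction y using fk_induction generalizing p with
  | one => simp
  | mul q y _ _ ih =>
    rw [map_mul, actHom_br, skewDer_br_mul, skewDer_br_mul, ← OrdPair.perm_mul,
      OrdPair.swap_perm, coord_perm, inv_mul_cancel_right, OrdPair.perm_mul, ih, map_add,
      map_mul, map_smul, actHom_br]
  | add x y hx hy => simp only [map_add, hx, hy]
  | smul c x hx => simp only [map_smul, hx]

/-- Skew derivations are homogeneous: `|∂_e y| = |e| |y|`. -/
lemma coact_skewDer (p : OrdPair N) (y : FK k N) : coactHom (k := k) (skewDer p y) =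
    TensorProduct.map (LinearMap.mulLeft k (MonoidAlgebra.single p.swap 1)) (skewDer p)
      (coactHom (k := k) y) := by
  induction y using fk_induction generalizing p with
  | one => simp [Algebra.TensorProduct.one_def]
  | mul q y h hy ih =>
    have hD : IsHomog (q.swap * p.swap * q.swap * h) (skewDer (p.perm q.swap) y) := by
      rw [IsHomog, ih, hy.isHomog, TensorProduct.map_tmul, OrdPair.swap_perm]
      simp [MonoidAlgebra.single_mul_single]
    rw [((IsHomog.br q).mul hy.isHomog), TensorProduct.map_tmul, skewDer_br_mul, map_add,
      map_smul, hy.isHomog, (IsHomog.br q).mul hD]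
    rcases coord_eq_zero_or (k := k) p q with h | h
    · simp [h, MonoidAlgebra.single_mul_single, ← mul_assoc]
    · simp [h, MonoidAlgebra.single_mul_single, TensorProduct.tmul_add, ← mul_assoc]
  | add x y hx hy => simp only [map_add, hx, hy]
  | smul c x hx => simp only [map_smul, hx]

lemma IsHomog.skewDer (p : OrdPair N) {h : Equiv.Perm (Fin N)} {y : FK k N} (hy : IsHomog h y) :
    IsHomog (p.swap * h) (skewDer p y) := by
  rw [IsHomog, coact_skewDer, hy]
  simp [MonoidAlgebra.single_mul_single]

lemma IsWord.skewDerHom {g h : Equiv.Perm (Fin N)} {x y : FK k N} (hx : IsWord g x)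
    (hy : IsHomog h y) : IsHomog (g * h) (skewDerHom k N x y) := by
  induction hx with
  | one => simpa using hy
  | mul p _ ih => simpa [mul_assoc] using ih.skewDer p

/-- The Leibniz rule for a product whose first factor is a word of degree `h`. -/
lemma skewDer_word_mul (p : OrdPair N) {h : Equiv.Perm (Fin N)} {y : FK k N} (hy : IsWord h y)
    (z : FK k N) : skewDer p (y * z) = skewDer p y * z + y * skewDer (p.perm h⁻¹) z := by
  induction hy generalizing p with
  | one => simp
  | mul q _ ih =>
    rw [mul_assoc, skewDer_br_mul, ih, skewDer_br_mul, mul_inv_rev, OrdPair.perm_mul, q.swap_inv]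
    simp only [mul_add, add_mul, smul_mul_assoc, mul_assoc, add_assoc]

/-- Skew derivations are right comodule maps. -/
lemma fkComul_skewDer (p : OrdPair N) (y : FK k N) :
    fkComul k N (skewDer p y) = (skewDer p).rTensor (FK k N) (fkComul k N y) := by
  -- This is coassociativity, with `⟨e, ·⟩` applied to the first of three tensor factors.
  have h1 : ∀ t, fkComul k N (TensorProduct.lid k _ ((coordMap p).rTensor _ t)) =
      TensorProduct.lid k _ ((coordMap p).rTensor _ ((fkComul k N).lTensor (FK k N) t)) := by
    intro t
    induction t using TensorProduct.induction_on with
    | zero => simp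
    | tmul u v => simp
    | add x y hx hy => simp only [map_add, hx, hy]
  have h2 : ∀ t : FK k N ⊗[k] FK k N, (skewDer p).rTensor (FK k N) t =
      TensorProduct.lid k _ ((coordMap p).rTensor _ (TensorProduct.assoc k _ _ _
        ((fkComul k N).rTensor (FK k N) t))) := by
    intro t
    induction t using TensorProduct.induction_on with
    | zero => simp
    | tmul u v =>
      rw [LinearMap.rTensor_tmul, skewDer_apply, LinearMap.rTensor_tmul]
      induction fkComul k N u using TensorProduct.induction_on with
      | zero => simp
      | tmul a b => simp [TensorProduct.smul_tmul']
      | add x y hx hy => simp only [map_add, TensorProduct.add_tmul, hx, hy]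
    | add x y hx hy => simp only [map_add, hx, hy]
  rw [h2, fkComul_coassoc, ← h1, skewDer_apply]

lemma fkComul_skewDerHom (x y : FK k N) : fkComul k N (skewDerHom k N x y) =
    (skewDerHom k N x).rTensor (FK k N) (fkComul k N y) := by
  induction x using fk_induction with
  | one => simp [Module.End.one_eq_id]
  | mul p x _ _ ih =>
    rw [map_mul, Module.End.mul_apply, skewDerHom_br, fkComul_skewDer, ih, Module.End.mul_eq_comp,
      LinearMap.rTensor_comp, LinearMap.comp_apply]
  | add x y hx hy => simp only [map_add, LinearMap.add_apply, LinearMap.rTensor_add, hx, hy]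
  | smul c x hx => simp only [map_smul, LinearMap.smul_apply, LinearMap.rTensor_smul, hx]

/-! ### The pairing -/

variable (k N) in
/-- The self-pairing `⟨x, y⟩ = ε(∂_x y)` of `E_N`. -/
def fkPairing : FK k N →ₗ[k] FK k N →ₗ[k] k :=
  (skewDerHom k N).toLinearMap.compr₂ (fkCounit k N).toLinearMap

lemma fkPairing_apply (x y : FK k N) :
    fkPairing k N x y = fkCounit k N (skewDerHom k N x y) := rfl

@[simp] lemma fkPairing_one_left (y : FK k N) : fkPairing k N 1 y = fkCounit k N y := by
  simp [fkPairing_apply]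

lemma fkPairing_mul (x x' y : FK k N) :
    fkPairing k N (x * x') y = fkPairing k N x (skewDerHom k N x' y) := by
  simp [fkPairing_apply]

lemma fkPairing_mul_br (x y : FK k N) (p : OrdPair N) :
    fkPairing k N (x * br k p) y = fkPairing k N x (skewDer p y) := by
  simp [fkPairing_mul]

@[simp] lemma fkPairing_br_br (p q : OrdPair N) :
    fkPairing k N (br k p) (br k q) = coord k p q := by
  have := skewDer_br_mul (k := k) p q 1
  rw [mul_one] at this
  simp [fkPairing_apply, this]

/-- `∂_x y = ⟨x, y₁⟩ y₂` for all `x`, as holds for symbols by definition. -/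
lemma skewDerHom_eq (x y : FK k N) : skewDerHom k N x y =
    TensorProduct.lid k _ ((fkPairing k N x).rTensor (FK k N) (fkComul k N y)) := by
  have h : fkPairing k N x = (fkCounit k N).toLinearMap ∘ₗ skewDerHom k N x := rfl
  rw [h, LinearMap.rTensor_comp, LinearMap.comp_apply, ← fkComul_skewDerHom,
    counit_rTensor_fkComul, TensorProduct.lid_tmul, one_smul]

@[simp] lemma fkPairing_one_right (x : FK k N) : fkPairing k N x 1 = fkCounit k N x := by
  induction x using fk_induction_right with
  | one => simp
  | mul p x => simp [fkPairing_mul_br]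
  | add x y hx hy => simp only [map_add, LinearMap.add_apply, hx, hy]
  | smul c x hx => simp only [map_smul, LinearMap.smul_apply, hx]

@[simp] lemma nestedPairing_tmul (x x' y y' : FK k N) :
    nestedPairing (fkPairing k N) (x ⊗ₜ x') (y ⊗ₜ y') =
      fkPairing k N x y' * fkPairing k N x' y := by
  simp [nestedPairing]

lemma nestedPairing_add_left (s s' t : FK k N ⊗[k] FK k N) :
    nestedPairing (fkPairing k N) (s + s') t =
      nestedPairing (fkPairing k N) s t + nestedPairing (fkPairing k N) s' t := by
  simp [nestedPairing]

lemma nestedPairing_smul_left (c : k) (s t : FK k N ⊗[k] FK k N) :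
    nestedPairing (fkPairing k N) (c • s) t = c • nestedPairing (fkPairing k N) s t := by
  simp [nestedPairing]

lemma nestedPairing_add_right (s t t' : FK k N ⊗[k] FK k N) :
    nestedPairing (fkPairing k N) s (t + t') =
      nestedPairing (fkPairing k N) s t + nestedPairing (fkPairing k N) s t' := by
  simp [nestedPairing]

lemma nestedPairing_smul_right (c : k) (s t : FK k N ⊗[k] FK k N) :
    nestedPairing (fkPairing k N) s (c • t) = c • nestedPairing (fkPairing k N) s t := by
  simp [nestedPairing]

lemma nestedPairing_tmul_left (x x' : FK k N) (t : FK k N ⊗[k] FK k N) :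
    nestedPairing (fkPairing k N) (x ⊗ₜ x') t =
      fkPairing k N x (TensorProduct.lid k _ ((fkPairing k N x').rTensor (FK k N) t)) := by
  induction t using TensorProduct.induction_on with
  | zero => simp [nestedPairing]
  | tmul y y' => simp [mul_comm]
  | add s t hs ht => simp only [nestedPairing_add_right, map_add, hs, ht]

lemma nestedPairing_tmul_left' (x x' : FK k N) (t : FK k N ⊗[k] FK k N) :
    nestedPairing (fkPairing k N) (x ⊗ₜ x') t =
      fkPairing k N x' (TensorProduct.rid k _ ((fkPairing k N x).lTensor (FK k N) t)) := by
  induction t using TensorProduct.induction_on with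
  | zero => simp [nestedPairing]
  | tmul y y' => simp
  | add s t hs ht => simp only [nestedPairing_add_right, map_add, hs, ht]

theorem fkPairing_mul_left (x x' y : FK k N) : fkPairing k N (x * x') y =
    nestedPairing (fkPairing k N) (x ⊗ₜ x') (fkComul k N y) := by
  rw [fkPairing_mul, nestedPairing_tmul_left, skewDerHom_eq]

theorem fkPairing_act (g : Equiv.Perm (Fin N)) (x y : FK k N) :
    fkPairing k N (actHom g x) (actHom g y) = fkPairing k N x y := by
  induction x using fk_induction_right generalizing y with
  | one => simp
  | mul p x ih => rw [map_mul, actHom_br, fkPairing_mul_br, skewDer_act, ih, fkPairing_mul_br]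
  | add x x' hx hx' => simp only [map_add, LinearMap.add_apply, hx, hx']
  | smul c x hx => simp only [map_smul, LinearMap.smul_apply, hx]

lemma IsHomog.counit_eq_zero {g : Equiv.Perm (Fin N)} {x : FK k N} (hx : IsHomog g x)
    (hg : g ≠ 1) : fkCounit k N x = 0 := by
  have h := counit_coact x
  rw [hx] at h
  -- Compare the coefficients of the neutral element.
  have h' := congrArg
    (fun t => (TensorProduct.rid k (MonoidAlgebra k (Equiv.Perm (Fin N))) t).coeff 1) h
  simpa [MonoidAlgebra.one_def, hg, eq_comm] using h'

/-- Words of degrees `g` and `h` are orthogonal unless `g h = 1`. -/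
lemma IsWord.fkPairing_eq_zero {g h : Equiv.Perm (Fin N)} {x y : FK k N} (hx : IsWord g x)
    (hy : IsWord h y) (hgh : g * h ≠ 1) : fkPairing k N x y = 0 :=
  (hx.skewDerHom hy.isHomog).counit_eq_zero hgh

theorem fkPairing_coact (x y : FK k N) :
    (TensorProduct.lift (fkPairing k N)).lTensor (MonoidAlgebra k (Equiv.Perm (Fin N)))
      ((crossed k N).tensorCoact (crossed k N) (x ⊗ₜ y)) = 1 ⊗ₜ fkPairing k N x y := by
  have key : ∀ t, (TensorProduct.lift (fkPairing k N)).lTensor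
      (MonoidAlgebra k (Equiv.Perm (Fin N))) ((crossed k N).tensorCoact (crossed k N) t) =
        1 ⊗ₜ TensorProduct.lift (fkPairing k N) t := by
    intro t
    induction t using tensor_word_induction with
    | tmul u v g h hu hv =>
      rw [tensorCoact_tmul hu.isHomog hv.isHomog, LinearMap.lTensor_tmul]
      by_cases hgh : g * h = 1
      · rw [hgh, MonoidAlgebra.one_def]
      · simp [hu.fkPairing_eq_zero hv hgh]
    | add x y hx hy => simp only [map_add, hx, hy, TensorProduct.tmul_add]
    | smul c x hx => simp only [map_smul, hx, TensorProduct.tmul_smul]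
  simpa using key (x ⊗ₜ y)

/-- The braided right multiplication by `e ⊗ 1 + 1 ⊗ e` is adjoint to the Leibniz rule: in the term
where `e` is braided past `v`, only `v` of degree `|y|⁻¹` pairs non-trivially with `y`. -/
lemma nestedPairing_braidedMul_br (p : OrdPair N) (s : FK k N ⊗[k] FK k N)
    {h : Equiv.Perm (Fin N)} {y : FK k N} (hy : IsWord h y) (y' : FK k N) :
    nestedPairing (fkPairing k N)
        (braidedMul (crossed k N) (s ⊗ₜ (br k p ⊗ₜ 1 + 1 ⊗ₜ br k p))) (y ⊗ₜ y') =
      nestedPairing (fkPairing k N) s (skewDer p y ⊗ₜ y' + y ⊗ₜ skewDer (p.perm h⁻¹) y') := by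
  induction s using tensor_word_induction with
  | tmul u v f g hu hv =>
    rw [TensorProduct.tmul_add, map_add, braidedMul_tmul hv.isHomog, braidedMul_tmul hv.isHomog,
      nestedPairing_add_left, nestedPairing_add_right, map_one, mul_one, mul_one, actHom_br]
    simp only [nestedPairing_tmul, fkPairing_mul_br]
    by_cases hgh : g * h = 1
    · rw [eq_inv_of_mul_eq_one_left hgh, add_comm]
    · simp [hv.fkPairing_eq_zero hy hgh]
  | add s t hs ht =>
    simp only [TensorProduct.add_tmul, map_add, nestedPairing_add_left, hs, ht]
  | smul c s hs => simp only [← TensorProduct.smul_tmul', map_smul, nestedPairing_smul_left, hs]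

theorem fkPairing_mul_right (x y y' : FK k N) : fkPairing k N x (y * y') =
    nestedPairing (fkPairing k N) (fkComul k N x) (y ⊗ₜ y') := by
  induction x using fk_induction_right generalizing y y' with
  | one => simp [mul_comm]
  | mul p x ih =>
    rw [fkPairing_mul_br, fkComul_mul, fkComul_br]
    induction y using word_induction with
    | word y h hy =>
      rw [nestedPairing_braidedMul_br p _ hy, skewDer_word_mul p hy, map_add, ih, ih,
        nestedPairing_add_right]
    | add y z hy hz =>
      simp only [add_mul, map_add, TensorProduct.add_tmul, nestedPairing_add_right, hy, hz]
    | smul c y hy =>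
      simp only [smul_mul_assoc, map_smul, ← TensorProduct.smul_tmul', nestedPairing_smul_right,
        hy]
  | add x x' hx hx' =>
    simp only [map_add, LinearMap.add_apply, nestedPairing_add_left, hx, hx']
  | smul c x hx => simp only [map_smul, LinearMap.smul_apply, nestedPairing_smul_left, hx]

/-! ### The antipode is self-adjoint -/

/-- The operator `y ↦ y₁ ⟨[ij], y₂⟩`. -/
def skewDerRight (p : OrdPair N) : Module.End k (FK k N) :=
  (TensorProduct.rid k (FK k N)).toLinearMap ∘ₗ (fkPairing k N (br k p)).lTensor (FK k N) ∘ₗ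
    fkComul k N

lemma skewDerRight_apply (p : OrdPair N) (y : FK k N) : skewDerRight p y =
    TensorProduct.rid k (FK k N)
      ((fkPairing k N (br k p)).lTensor (FK k N) (fkComul k N y)) := rfl

/-- Left multiplication by a symbol is adjoint to the right-handed skew derivation. -/
lemma fkPairing_br_mul (p : OrdPair N) (x y : FK k N) :
    fkPairing k N (br k p * x) y = fkPairing k N x (skewDerRight p y) := by
  rw [fkPairing_mul_left, nestedPairing_tmul_left', skewDerRight_apply]

lemma skewDerRight_act (g : Equiv.Perm (Fin N)) (p : OrdPair N) (y : FK k N) :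
    skewDerRight (p.perm g) (actHom g y) = actHom g (skewDerRight p y) := by
  rw [skewDerRight_apply, skewDerRight_apply, fkComul_act]
  induction fkComul k N y using TensorProduct.induction_on with
  | zero => simp
  | tmul u v => simp [← actHom_br, fkPairing_act]
  | add x y hx hy => simp only [map_add, hx, hy]

lemma skewDerRight_mul_br (p q : OrdPair N) (y : FK k N) : skewDerRight p (y * br k q) =
    skewDerRight p y * br k (q.perm p.swap) + coord k p q • y := by
  have key : ∀ t, TensorProduct.rid k (FK k N) ((fkPairing k N (br k p)).lTensor (FK k N)
      (braidedMul (crossed k N) (t ⊗ₜ (br k q ⊗ₜ 1 + 1 ⊗ₜ br k q)))) =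
      TensorProduct.rid k (FK k N) ((fkPairing k N (br k p)).lTensor (FK k N) t) *
        br k (q.perm p.swap) +
      coord k p q • TensorProduct.rid k (FK k N)
        ((fkCounit k N).toLinearMap.lTensor (FK k N) t) := by
    intro t
    induction t using tensor_word_induction with
    | tmul u v g h hu hv =>
      rw [TensorProduct.tmul_add, map_add, braidedMul_tmul hv.isHomog,
        braidedMul_tmul hv.isHomog]
      have h1 : fkPairing k N (br k p) (v * br k q) = coord k p q * fkCounit k N v := by
        rw [fkPairing_mul_right, fkComul_br, nestedPairing_add_left]
        simp
      have h2 : fkPairing k N (br k p) v • (u * br k (q.perm h)) =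
          fkPairing k N (br k p) v • (u * br k (q.perm p.swap)) := by
        by_cases hph : p.swap * h = 1
        · rw [eq_inv_of_mul_eq_one_right hph, p.swap_inv]
        · simp [(IsWord.br p).fkPairing_eq_zero hv hph]
      simp [h1, h2, mul_smul]
    | add s t hs ht =>
      simp only [TensorProduct.add_tmul, map_add, hs, ht, add_mul, smul_add]
      abel
    | smul c s hs =>
      simp only [← TensorProduct.smul_tmul', map_smul, hs, smul_mul_assoc, smul_add]
      rw [smul_comm c]
  rw [skewDerRight_apply, fkComul_mul, fkComul_br, key, counit_lTensor_fkComul,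
    TensorProduct.rid_tmul, one_smul, ← skewDerRight_apply]

/-- The antipode intertwines right and left skew derivations. -/
lemma skewDerRight_fkAntipode (p : OrdPair N) (y : FK k N) :
    skewDerRight p (fkAntipode k N y) = -fkAntipode k N (actHom p.swap (skewDer p y)) := by
  induction y using fk_induction generalizing p with
  | one => simp [skewDerRight_apply]
  | mul q y _ _ ih =>
    have h : skewDerRight p (actHom q.swap (fkAntipode k N y)) =
        -actHom (p.swap * q.swap) (fkAntipode k N (skewDer (p.perm q.swap) y)) := by
      have hp : p = (p.perm q.swap).perm q.swap := by simp [← OrdPair.perm_mul]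
      conv_lhs => rw [hp]
      rw [skewDerRight_act, ih, fkAntipode_act, OrdPair.swap_perm, map_neg, ← actHom_mul_apply]
      simp [← mul_assoc]
    have hc : coord k p q • actHom q.swap (fkAntipode k N y) =
        coord k p q • actHom p.swap (fkAntipode k N y) := by
      rcases coord_eq_zero_or (k := k) p q with h | h
      · simp [h]
      · rw [h]
    rw [fkAntipode_br_mul, map_neg, skewDerRight_mul_br, h, hc, skewDer_br_mul, map_add,
      map_add, map_smul, map_smul, map_mul, actHom_br, fkAntipode_br_mul, fkAntipode_act,
      fkAntipode_act, ← actHom_mul_apply, OrdPair.swap_perm]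
    simp [mul_assoc]
    abel
  | add x y hx hy =>
    simp only [map_add, hx, hy]
    abel
  | smul c x hx => simp only [map_smul, hx, smul_neg]

theorem fkPairing_fkAntipode (x y : FK k N) :
    fkPairing k N (fkAntipode k N x) y = fkPairing k N x (fkAntipode k N y) := by
  induction x using fk_induction generalizing y with
  | one =>
    induction y using fk_induction with
    | one => simp
    | mul q y => simp
    | add x y hx hy => simp only [map_add, hx, hy]
    | smul c x hx => simp only [map_smul, hx]
  | mul p x _ _ ih =>
    rw [fkAntipode_br_mul, map_neg, LinearMap.neg_apply, fkPairing_mul_br, fkPairing_br_mul,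
      skewDerRight_fkAntipode, map_neg, ← ih, neg_inj]
    conv_rhs => rw [← fkPairing_act p.swap, actHom_swap_swap]
  | add x x' hx hx' => simp only [map_add, LinearMap.add_apply, hx, hx']
  | smul c x hx => simp only [map_smul, LinearMap.smul_apply, hx]

theorem isBraidedPairing_fkPairing :
    IsBraidedPairing (fkBraidedGroup k N) (fkBraidedGroup k N) (fkPairing k N) where
  act_invariant := fkPairing_act
  coact_invariant := fkPairing_coact
  one_left := fkPairing_one_left
  one_right := fkPairing_one_right
  mul_left := fkPairing_mul_left
  mul_right := fkPairing_mul_right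
  antipode_adjoint := fkPairing_fkAntipode

/-! ### Braided integers -/

lemma idTensor_one (m : ℕ) :
    idTensor (1 : Matrix (Fin m → Cyc N) (Fin m → Cyc N) k) = 1 := by
  ext c b
  by_cases h : c = b
  · subst h; simp [idTensor]
  · have : c 0 = b 0 → Fin.tail c ≠ Fin.tail b := fun h0 ht =>
      h (by rw [← Fin.cons_self_tail c, ← Fin.cons_self_tail b, h0, ht])
    by_cases h0 : c 0 = b 0
    · simp [idTensor, h, h0, this h0]
    · simp [idTensor, h, h0]

lemma idTensor_add {m : ℕ} (A B : Matrix (Fin m → Cyc N) (Fin m → Cyc N) k) :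
    idTensor (A + B) = idTensor A + idTensor B := by
  ext c b
  by_cases h0 : c 0 = b 0 <;> simp [idTensor, h0]

@[simp] lemma idTensor_cons {m : ℕ} (A : Matrix (Fin m → Cyc N) (Fin m → Cyc N) k)
    (c : Fin (m + 1) → Cyc N) (d : Fin m → Cyc N) :
    idTensor A c (Fin.cons (c 0) d : Fin (m + 1) → Cyc N) = A (Fin.tail c) d := by
  simp [idTensor]

lemma sum_word_succ {M : Type*} [AddCommMonoid M] {m : ℕ} (f : (Fin (m + 1) → Cyc N) → M) :
    ∑ c, f c = ∑ a, ∑ d, f (Fin.cons a d) := by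
  rw [← Fintype.sum_prod_type' (f := fun a d => f (Fin.cons a d))]
  exact (Fintype.sum_equiv (Fin.consEquiv fun _ => Cyc N) _ _ fun _ => rfl).symm

lemma idTensor_mul {m : ℕ} (A B : Matrix (Fin m → Cyc N) (Fin m → Cyc N) k) :
    idTensor (A * B) = idTensor A * idTensor B := by
  ext c b
  rw [Matrix.mul_apply, sum_word_succ]
  simp only [idTensor, Fin.cons_zero, Fin.tail_cons, Matrix.mul_apply]
  by_cases h : c 0 = b 0
  · rw [Finset.sum_eq_single (b 0)]
    · simp [h]
    · intro a _ ha; simp [ha]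
    · simp
  · rw [if_neg h]
    refine (Finset.sum_eq_zero fun a _ => Finset.sum_eq_zero fun d _ => ?_).symm
    by_cases ha : c 0 = a
    · simp [← ha, h]
    · simp [ha]

lemma idTensor_psiAt {m : ℕ} (i : Fin m) : idTensor (psiAt k N i) = psiAt k N i.succ := by
  ext c b
  have h1 : (0 : Fin (m + 2)) ≠ i.succ.castSucc := by simp [Fin.ext_iff]
  have h2 : (0 : Fin (m + 2)) ≠ i.succ.succ := by simp [Fin.ext_iff]
  by_cases h0 : c 0 = b 0
  · rw [idTensor, if_pos h0, psiAt, psiAt]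
    refine if_congr ⟨fun H j => ?_, fun H j hj hj' => ?_⟩ rfl rfl
    · refine Fin.cases (fun _ _ => h0) (fun j hj hj' => ?_) j
      refine H j (fun h => hj ?_) fun h => hj' ?_
      · rw [h, Fin.succ_castSucc]
      · rw [h]
    · refine H j.succ (fun h => hj ?_) fun h => hj' ?_
      · rwa [← Fin.succ_castSucc, Fin.succ_inj] at h
      · rwa [Fin.succ_inj] at h
  · rw [idTensor, if_neg h0, psiAt, if_neg fun H => h0 (H 0 h1 h2)]

/-- `[m + 2, Ψ] = id + Ψ₁₂ (id ⊗ [m + 1, Ψ])`. -/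
lemma braidedInt_succ (m : ℕ) :
    braidedInt k N (m + 1) = 1 + psiAt k N 0 * idTensor (braidedInt k N m) := by
  have hsum : ∀ {ι : Type} (s : Finset ι)
      (f : ι → Matrix (Fin (m + 1) → Cyc N) (Fin (m + 1) → Cyc N) k),
      idTensor (∑ i ∈ s, f i) = ∑ i ∈ s, idTensor (f i) := fun s f =>
    map_sum (AddMonoidHom.mk' idTensor idTensor_add) f s
  have hprod : ∀ l : List (Matrix (Fin (m + 1) → Cyc N) (Fin (m + 1) → Cyc N) k),
      idTensor l.prod = (l.map idTensor).prod := by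
    intro l
    induction l with
    | nil => exact idTensor_one _
    | cons A l ih => rw [List.prod_cons, idTensor_mul, ih, List.map_cons, List.prod_cons]
  rw [braidedInt, Fin.sum_univ_succ, braidedInt, hsum, Finset.mul_sum]
  congr 1
  refine Finset.sum_congr rfl fun r _ => ?_
  rw [hprod]
  simp only [Fin.val_succ, List.finRange_succ, List.map_cons, List.prod_cons, List.map_map]
  congr 2
  refine List.map_congr_left fun i _ => ?_
  simp only [Function.comp_apply, idTensor_psiAt]
  rfl

lemma braidedInt_zero : braidedInt k N 0 = 1 := by simp [braidedInt]

/-! ### The pairing on monomials -/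

/-- The label of `[ij]` as an ordered pair, for a 2-cycle `(ij)` with `i < j`. -/
def Cyc.toOrdPair (a : Cyc N) : OrdPair N := ⟨a.1, a.2.ne⟩

lemma gen_eq (a : Cyc N) : gen k a = br k a.toOrdPair := rfl

lemma coord_toOrdPair (a b : Cyc N) :
    coord k a.toOrdPair b.toOrdPair = if a = b then 1 else 0 := by
  have h : a.toOrdPair ≠ b.toOrdPair.rev := fun h => by
    have h1 : a.1.1 = b.1.2 := congrArg (fun q : OrdPair N => q.1.1) h
    have h2 : a.1.2 = b.1.1 := congrArg (fun q : OrdPair N => q.1.2) h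
    have := a.2
    rw [h1, h2] at this
    exact lt_asymm this b.2
  have h' : a.toOrdPair = b.toOrdPair ↔ a = b := by simp [Cyc.toOrdPair, Subtype.ext_iff]
  rw [coord, if_neg h, sub_zero]
  exact if_congr h' rfl rfl

lemma Cyc.swap_swap_apply (b : Cyc N) (i : Fin N) : b.swap (b.swap i) = i :=
  Equiv.swap_apply_self _ _ _

@[simp] lemma Cyc.conj_swap_conj_swap (a b : Cyc N) : (a.conj b.swap).conj b.swap = a := by
  by_cases h : b.swap a.1.1 < b.swap a.1.2
  · have hc : a.conj b.swap = ⟨(b.swap a.1.1, b.swap a.1.2), h⟩ := dif_pos h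
    rw [hc, Cyc.conj, dif_pos (by simpa only [b.swap_swap_apply] using a.2)]
    exact Subtype.ext (Prod.ext (b.swap_swap_apply _) (b.swap_swap_apply _))
  · have hc : a.conj b.swap = ⟨(b.swap a.1.2, b.swap a.1.1), lt_of_le_of_ne (not_lt.mp h)
      fun h' => a.2.ne' (b.swap.injective h')⟩ := dif_neg h
    rw [hc, Cyc.conj, dif_neg (by simpa only [b.swap_swap_apply] using a.2.not_gt)]
    exact Subtype.ext (Prod.ext (b.swap_swap_apply _) (b.swap_swap_apply _))

lemma zeta_conj_swap (a b : Cyc N) : zeta k b.swap (a.conj b.swap) = zeta k b.swap a := by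
  by_cases h : b.swap a.1.1 < b.swap a.1.2
  · have hc : a.conj b.swap = ⟨(b.swap a.1.1, b.swap a.1.2), h⟩ := dif_pos h
    simp [hc, zeta, b.swap_swap_apply, a.2, h]
  · have hc : a.conj b.swap = ⟨(b.swap a.1.2, b.swap a.1.1), lt_of_le_of_ne (not_lt.mp h)
      fun h' => a.2.ne' (b.swap.injective h')⟩ := dif_neg h
    simp [hc, zeta, b.swap_swap_apply, a.2.not_gt, h]

/-- The entries of `Ψ₁₂ (id ⊗ A)`. -/
lemma psiAt_mul_idTensor {m : ℕ} (A : Matrix (Fin (m + 1) → Cyc N) (Fin (m + 1) → Cyc N) k)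
    (a c : Cyc N) (d : Fin m → Cyc N) (b : Fin (m + 2) → Cyc N) :
    (psiAt k N 0 * idTensor A : Matrix _ _ k)
        (Fin.cons a (Fin.cons c d : Fin (m + 1) → Cyc N) : Fin (m + 2) → Cyc N) b =
      if c = b 0 then zeta k (b 0).swap a *
        A (Fin.cons (a.conj (b 0).swap) d : Fin (m + 1) → Cyc N) (Fin.tail b) else 0 := by
  have hne : ∀ j : Fin m, j.succ.succ ≠ (0 : Fin (m + 1)).castSucc ∧
      j.succ.succ ≠ (0 : Fin (m + 1)).succ := fun j => by simp [Fin.ext_iff]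
  rw [Matrix.mul_apply, Finset.sum_eq_single
    (Fin.cons (b 0) (Fin.cons (a.conj (b 0).swap) d : Fin (m + 1) → Cyc N) :
      Fin (m + 2) → Cyc N)]
  · rw [idTensor, if_pos (Fin.cons_zero ..), Fin.tail_cons, psiAt, if_pos]
    · by_cases h : c = b 0
      · simp [psi, h, zeta_conj_swap]
      · simp [psi, h]
    · intro j h1 h2
      induction j using Fin.cases with
      | zero => exact absurd rfl h1
      | succ j =>
        induction j using Fin.cases with
        | zero => exact absurd rfl h2
        | succ j => simp
  · intro w _ hw
    by_contra h
    obtain ⟨hp, hi⟩ := ne_zero_and_ne_zero_of_mul h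
    have h0 : w 0 = b 0 := by
      by_contra h0
      exact hi (if_neg h0)
    have hd : ∀ j : Fin m, d j = w j.succ.succ := by
      intro j
      by_contra hj
      exact hp (if_neg fun H => hj (H j.succ.succ (hne j).1 (hne j).2))
    have h1 : a = (w 1).conj (w 0).swap := by
      by_contra h1
      refine hp ?_
      rw [psiAt]
      split_ifs
      · exact if_neg fun H => h1 (congrArg Prod.fst H)
      · rfl
    refine hw (funext fun j => ?_)
    induction j using Fin.cases with
    | zero => exact h0
    | succ j =>
      induction j using Fin.cases with
      | zero =>
        rw [h1, h0]
        simp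
      | succ j => simp [hd]
  · simp

lemma skewDer_perm_toOrdPair (g : Equiv.Perm (Fin N)) (a : Cyc N) :
    skewDer (k := k) (a.toOrdPair.perm g) = zeta k g a • skewDer (a.conj g).toOrdPair := by
  by_cases h : g a.1.1 < g a.1.2
  · simp [zeta, Cyc.conj, h, Cyc.toOrdPair, OrdPair.perm]
  · have hz : zeta k g a = -1 := if_neg h
    have hc : (a.conj g).toOrdPair = (a.toOrdPair.perm g).rev := by
      simp only [Cyc.conj, dif_neg h]; rfl
    rw [hz, hc, skewDer_rev, smul_neg, neg_smul, one_smul, neg_neg]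

lemma fkMonomial_succ {m : ℕ} (b : Fin (m + 1) → Cyc N) :
    fkMonomial k b = gen k (b 0) * fkMonomial k (Fin.tail b) := by
  simp [fkMonomial, List.ofFn_succ, Fin.tail]

lemma fkMonomial_cons {m : ℕ} (a : Cyc N) (b : Fin m → Cyc N) :
    fkMonomial k (Fin.cons a b : Fin (m + 1) → Cyc N) = gen k a * fkMonomial k b := by
  rw [fkMonomial_succ, Fin.cons_zero, Fin.tail_cons]

lemma fkMonomial_rev {m : ℕ} (a : Fin (m + 1) → Cyc N) :
    fkMonomial k (a ∘ Fin.rev) = fkMonomial k (Fin.tail a ∘ Fin.rev) * gen k (a 0) := by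
  rw [fkMonomial, fkMonomial, List.ofFn_succ', List.concat_eq_append, List.prod_append,
    List.prod_singleton]
  simp [Fin.tail, Fin.rev_castSucc]

lemma skewDer_gen_mul (a b : Cyc N) (y : FK k N) :
    skewDer a.toOrdPair (gen k b * y) = (if a = b then (1 : k) else 0) • y +
      zeta k b.swap a • (gen k b * skewDer (a.conj b.swap).toOrdPair y) := by
  have h := skewDer_perm_toOrdPair (k := k) b.swap a
  have hs : b.toOrdPair.swap = b.swap := rfl
  rw [gen_eq, skewDer_br_mul, coord_toOrdPair, hs, h, LinearMap.smul_apply, mul_smul_comm]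

/-- On monomials the skew derivations are given by the braided integers. -/
theorem skewDer_fkMonomial {m : ℕ} (a : Cyc N) (b : Fin (m + 1) → Cyc N) :
    skewDer a.toOrdPair (fkMonomial k b) =
      ∑ c : Fin m → Cyc N, braidedInt k N m (Fin.cons a c : Fin (m + 1) → Cyc N) b •
        fkMonomial k c := by
  have hone : ∀ {m : ℕ} (a : Cyc N) (b : Fin (m + 1) → Cyc N), ∑ c : Fin m → Cyc N,
      (1 : Matrix (Fin (m + 1) → Cyc N) (Fin (m + 1) → Cyc N) k)
        (Fin.cons a c : Fin (m + 1) → Cyc N) b • fkMonomial k c =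
      (if a = b 0 then (1 : k) else 0) • fkMonomial k (Fin.tail b) := by
    intro m a b
    rw [Finset.sum_eq_single (Fin.tail b)]
    · congr 1
      rw [Matrix.one_apply]
      refine if_congr ⟨fun h => by rw [← h, Fin.cons_zero], fun h => ?_⟩ rfl rfl
      rw [h, Fin.cons_self_tail]
    · intro c _ hc
      rw [Matrix.one_apply_ne, zero_smul]
      rintro rfl
      exact hc (Fin.tail_cons (α := fun _ => Cyc N) a c).symm
    · simp
  induction m generalizing a with
  | zero =>
    have ht : fkMonomial k (Fin.tail b) = 1 := by simp [fkMonomial]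
    rw [braidedInt_zero, hone, fkMonomial_succ, skewDer_gen_mul, ht, skewDer_one, mul_zero,
      smul_zero, add_zero]
  | succ m ih =>
    rw [braidedInt_succ]
    simp only [Matrix.add_apply, add_smul, Finset.sum_add_distrib]
    rw [hone, fkMonomial_succ, skewDer_gen_mul, ih _ (Fin.tail b), sum_word_succ]
    congr 1
    simp only [psiAt_mul_idTensor, fkMonomial_cons, ite_smul, zero_smul]
    rw [Finset.sum_comm]
    simp [Finset.mul_sum, Finset.smul_sum, mul_smul]

/-- On monomials the pairing is given by the braided factorials. -/
theorem fkPairing_fkMonomial (n m : ℕ) (a : Fin n → Cyc N) (b : Fin m → Cyc N) :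
    fkPairing k N (fkMonomial k (a ∘ Fin.rev)) (fkMonomial k b) =
      if h : n = m then braidedFactorial k N n a (b ∘ Fin.cast h) else 0 := by
  induction n generalizing m with
  | zero =>
    have ha : fkMonomial k (a ∘ Fin.rev) = 1 := by simp [fkMonomial]
    rw [ha, fkPairing_one_left]
    cases m with
    | zero =>
      have hb : fkMonomial k b = 1 := by simp [fkMonomial]
      rw [hb, map_one, dif_pos rfl, braidedFactorial, Matrix.one_apply, if_pos]
      exact Subsingleton.elim _ _
    | succ m => simp [fkMonomial_succ, gen_eq]
  | succ n ih =>
    rw [fkMonomial_rev, gen_eq, fkPairing_mul_br]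
    cases m with
    | zero => simp [fkMonomial]
    | succ m =>
      rw [skewDer_fkMonomial, map_sum]
      simp only [map_smul, ih]
      by_cases h : n = m
      · subst h
        have hb : b ∘ Fin.cast rfl = b := rfl
        rw [dif_pos rfl, braidedFactorial, Matrix.mul_apply, sum_word_succ,
          Finset.sum_eq_single (a 0)]
        · refine Finset.sum_congr rfl fun c _ => ?_
          rw [dif_pos rfl, idTensor_cons, smul_eq_mul, mul_comm]
          rfl
        · intro c _ hc
          refine Finset.sum_eq_zero fun d _ => ?_
          rw [idTensor, if_neg, zero_mul]
          rw [Fin.cons_zero]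
          exact hc.symm
        · simp
      · simp [h]

end FominKirillov

end

theorem proposition6p4 (k : Type*) [Field k] [CharZero k] (N : ℕ) :
    ∃ H : BraidedGroup (crossed k N),
      (∀ a : Cyc N, H.comul (gen k a) = gen k a ⊗ₜ 1 + 1 ⊗ₜ gen k a) ∧
      (∀ a : Cyc N, H.counit (gen k a) = 0) ∧
      ∃ p : FK k N →ₗ[k] FK k N →ₗ[k] k,
        IsBraidedPairing H H p ∧
        (∀ a b : Cyc N, p (gen k a) (gen k b) = if a = b then 1 else 0) ∧
        (∀ (n m : ℕ) (a : Fin n → Cyc N) (b : Fin m → Cyc N),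
          p (fkMonomial k (a ∘ Fin.rev)) (fkMonomial k b) =
            if h : n = m then braidedFactorial k N n a (b ∘ Fin.cast h) else 0) := by
  refine ⟨fkBraidedGroup k N, fun a => fkComul_br _, fun a => fkCounit_br _, fkPairing k N,
    isBraidedPairing_fkPairing, fun a b => ?_, fkPairing_fkMonomial⟩
  rw [gen_eq, gen_eq, fkPairing_br_br, coord_toOrdPair]
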